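/- A direction is a unit vector in the Euclidean plane $\mathbb R^2$. For a set $\Omega$ of directions, two distinct points $a,b\in\Omega$ are neighboring points of $\Omega$ if one of the two open arcs of the unit circle with endpoints $a,b$ contains no point of $\Omega$; such an arc is called a gap of $\Omega$. A set $\Omega$ of directions is $1$-lacunary if it can be listed as a finite (possibly empty) or infinite sequence $v_1,v_2,\dots$ of distinct directions such that consecutive terms $v_k,v_{k+1}$ are neighboring points of $\Omega$, and there is a direction $v_\infty$ with $$\tfrac12|v_k-v_{k+1}|<|v_{k+1}-v_\infty|<|v_k-v_{k+1}|$$ for all consecutive terms. Inductively, for integers $N\ge1$, a set $\Omega$ is $(N+1)$-lacunary if there is an $N$-lacunary set $\Omega_N\subseteq\Omega$ such that every point of $\Omega\setminus\Omega_N$ lies in a gap of $\Omega_N$, and the points of $\Omega$ lying in any given gap of $\Omega_N$ form a $1$-lacunary set. For a set $\Omega$ of directions, let $$M_\Omega f(x)=\sup_{x\in R\in\mathcal R_\Omega}\frac1{|R|}\int_R|f(y)|\,dy,$$ where $\mathcal R_\Omega$ is the set of all (nondegenerate) rectangles in the plane that have a side parallel to some direction from $\Omega$. Then there are absolute constants $C,K>0$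 such that: 1. for every $n\ge 2$, every set $\Omega$ of $n$ directions is $(C\log n)$-lacunary, that is, $\Omega$ is $N$-lacunary for some integer $1\le N\le C\log n$; 2. (Katz's theorem) for every finite set of directions $\Omega$ with $\#\Omega\ge2$ and every $f\in L^2(\mathbb R^2)$, the function $M_\Omega f$ is measurable and $$\|M_\Omega f\|_{2}\le K\,\log(\#\Omega)\,\|f\|_{2}.$$ -/

import Mathlib

open MeasureTheory
open scoped ENNReal

noncomputable section

/-- The Euclidean plane. -/
abbrev Plane : Type := EuclideanSpace ℝ (Fin 2)

/-- The direction (unit vector) at angle `t`. -/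
def dirOfAngle (t : ℝ) : Plane := !₂[Real.cos t, Real.sin t]

/-- The open arc of the unit circle swept counterclockwise from angle `s` to angle `t`
(used for `s < t < s + 2π`). -/
def openArc (s t : ℝ) : Set Plane := dirOfAngle '' Set.Ioo s t

/-- The angles `s < t < s + 2π` bound a gap of `Ω`: their directions are two distinct points
of `Ω`, and no point of `Ω` lies on the open arc from the first one to the second. -/
def IsGap (Ω : Set Plane) (s t : ℝ) : Prop :=
  s < t ∧ t < s + 2 * Real.pi ∧ dirOfAngle s ∈ Ω ∧ dirOfAngle t ∈ Ω ∧
    Disjoint (openArc s t) Ω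

/-- `a` and `b` are neighboring points of `Ω`: two distinct points of `Ω` such that one of the
two open arcs of the unit circle between them contains no point of `Ω`. -/
def AreNeighbors (Ω : Set Plane) (a b : Plane) : Prop :=
  ∃ s t : ℝ, IsGap Ω s t ∧
    ((dirOfAngle s = a ∧ dirOfAngle t = b) ∨ (dirOfAngle s = b ∧ dirOfAngle t = a))

/-- `Ω` is a `1`-lacunary set of directions. It is listed by a finite or infinite sequence
`v 0, v 1, …` of `L ≤ ∞` distinct unit vectors (`L = 0`, the empty set, is allowed: it means
that nothing is added in a gap), consecutive terms are neighboring points of `Ω`, and the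
inequalities hold for some direction `w` (the direction `v_∞`). -/
def IsOneLacunary (Ω : Set Plane) : Prop :=
  ∃ (L : ℕ∞) (v : ℕ → Plane) (w : Plane),
    Ω = v '' {k : ℕ | (k : ℕ∞) < L} ∧
    Set.InjOn v {k : ℕ | (k : ℕ∞) < L} ∧
    (∀ k : ℕ, (k : ℕ∞) < L → ‖v k‖ = 1) ∧ ‖w‖ = 1 ∧
    ∀ k : ℕ, ((k + 1 : ℕ) : ℕ∞) < L →
      AreNeighbors Ω (v k) (v (k + 1)) ∧
      (1 / 2) * ‖v k - v (k + 1)‖ < ‖v (k + 1) - w‖ ∧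
      ‖v (k + 1) - w‖ < ‖v k - v (k + 1)‖

/-- `N`-lacunary sets of directions, `N ≥ 1`. An `(N+1)`-lacunary set `Ω` arises from an
`N`-lacunary set `Ω'` by adding points in gaps between neighboring points of `Ω'`,
the points added in each gap forming a `1`-lacunary sequence. -/
inductive IsLacunary : ℕ → Set Plane → Prop
  | one (Ω : Set Plane) (h : IsOneLacunary Ω) : IsLacunary 1 Ω
  | succ (N : ℕ) (Ω' Ω : Set Plane) (h : IsLacunary N Ω') (hsub : Ω' ⊆ Ω)
      (hmem : ∀ x ∈ Ω, x ∉ Ω' → ∃ s t : ℝ, IsGap Ω' s t ∧ x ∈ openArc s t)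
      (hgap : ∀ s t : ℝ, IsGap Ω' s t → IsOneLacunary (Ω ∩ openArc s t)) :
      IsLacunary (N + 1) Ω

/-- Rotation by a right angle. -/
def perpVec (v : Plane) : Plane := !₂[-(v 1), v 0]

/-- For a unit vector `v`: the closed rectangle with center `c`, with sides of length `2 * a`
parallel to `v` and sides of length `2 * b` perpendicular to `v`. -/
def rect (c v : Plane) (a b : ℝ) : Set Plane :=
  {y | |inner ℝ (y - c) v| ≤ a ∧ |inner ℝ (y - c) (perpVec v)| ≤ b}

/-- The nondegenerate rectangles with a side parallel to some direction of `Ω`. -/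
def directionRects (Ω : Set Plane) : Set (Set Plane) :=
  {R | ∃ v ∈ Ω, ∃ (c : Plane) (a b : ℝ), 0 < a ∧ 0 < b ∧ R = rect c v a b}

/-- The maximal function over all rectangles containing `x` that have a side parallel to some
direction of `Ω`. -/
def dirMaximal (Ω : Set Plane) (f : Plane → ℂ) (x : Plane) : ℝ≥0∞ :=
  ⨆ R ∈ directionRects Ω, ⨆ _ : x ∈ R, (volume R)⁻¹ * ∫⁻ y in R, ‖f y‖ₑ

end

/-!
A set of `n` directions is listed by increasing angle. If `2 ^ k < n ≤ 2 ^ (k + 1)`, the directions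
with indices `0` and `2 ^ k` form a `1`-lacunary set, and passing from the indices divisible by
`2 ^ (j + 1)` to those divisible by `2 ^ j` adds at most one direction to each gap
(`subsingleton_dyadicDirs_inter`, `exists_gap_of_mem_dyadicDirs`). So `k + 1` steps suffice.

For the bound on the maximal function, a rectangle is enclosed, after a possible exchange of the
coordinates, in a parallelogram of comparable area with two vertical sides, whose slope comes from a
set of at most `2 n` slopes and whose other parameters are rational (`exists_rat_par`). By monotone
convergence it remains to treat a finite family of parallelograms `P i`. The maximal average is
linearized by disjoint sets `E i ⊆ P i`, and one bounds the adjoint, which sends `g ≥ 0` to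
`S = ∑ i, (∫_{E i} g) / |P i| * 1_{P i}`. The norm of `S` is at most `36 + 6912 k` times the norm
of `g` if there are at most `2 ^ k` slopes. This goes by induction on `k` (`adjointBound_par`):

* Let `m₀` be a median of the slopes and `S = S₁ + S₂` the splitting according to the side of `m₀`.
  Then `‖S‖² = ‖S₁‖² + ‖S₂‖² + 2 ⟨S₁, S₂⟩`. As the sets `E i` are disjoint, the first two terms
  together satisfy the bound of the previous step, with the same constant.
* If `m₀` lies between the slopes of `P` and `P'`, the relative overlap `|P ∩ P'| / (|P| |P'|)`
  drops at most by a constant factor when the shorter one of the two is replaced by a parallelogram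
  of slope `m₀` that contains it (`rel_overlap_le`). So the cross term is at most a constant times
  `⟨S₀, S⟩`, where `S₀` belongs to a family of the single slope `m₀`, hence at most a constant times
  `‖g‖ ‖S‖`. The resulting quadratic inequality for `‖S‖` shows that the constant only grows by an
  additive amount.

For a single slope a shear reduces the bound to axis-parallel rectangles, and those to intervals
(`MaxBound.prod`). For intervals the same expansion of the square bounds `‖S‖²` by `6 ‖g‖` times the
norm of the function obtained by tripling all intervals; iterating this gives `‖S‖ ≤ 6 ‖g‖`
(`adjointBound_closedBall`).
-/

/-! ### Averages over finite families of sets and their adjoints -/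

section Averages

variable {α ι : Type*} [MeasurableSpace α]

/-- The `L²` norm of a function with values in `[0, ∞]`. -/
noncomputable def l2norm (μ : Measure α) (f : α → ℝ≥0∞) : ℝ≥0∞ :=
  (∫⁻ x, f x ^ 2 ∂μ) ^ (1 / 2 : ℝ)

lemma l2norm_sq (μ : Measure α) (f : α → ℝ≥0∞) : l2norm μ f ^ 2 = ∫⁻ x, f x ^ 2 ∂μ := by
  rw [l2norm, ← ENNReal.rpow_natCast, ← ENNReal.rpow_mul]
  norm_num

lemma l2norm_mono {μ : Measure α} {f g : α → ℝ≥0∞} (h : ∀ x, f x ≤ g x) :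
    l2norm μ f ≤ l2norm μ g := by
  unfold l2norm
  gcongr with x
  exact h x

lemma l2norm_le_of_sq_le {μ : Measure α} {f : α → ℝ≥0∞} {c : ℝ≥0∞}
    (h : ∫⁻ x, f x ^ 2 ∂μ ≤ c ^ 2) : l2norm μ f ≤ c := by
  rw [← l2norm_sq] at h
  exact (ENNReal.pow_le_pow_left_iff two_ne_zero).1 h

lemma lintegral_mul_le_l2norm (μ : Measure α) {f g : α → ℝ≥0∞} (hf : AEMeasurable f μ)
    (hg : AEMeasurable g μ) : ∫⁻ x, f x * g x ∂μ ≤ l2norm μ f * l2norm μ g := by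
  have h := ENNReal.lintegral_mul_le_Lp_mul_Lq μ Real.HolderConjugate.two_two hf hg
  simpa [l2norm] using h

lemma l2norm_const_mul (μ : Measure α) (c : ℝ≥0∞) {f : α → ℝ≥0∞} (hf : Measurable f) :
    l2norm μ (fun x => c * f x) = c * l2norm μ f := by
  unfold l2norm
  simp_rw [mul_pow]
  rw [lintegral_const_mul _ (hf.pow_const 2), ENNReal.mul_rpow_of_nonneg _ _ (by norm_num),
    ← ENNReal.rpow_natCast, ← ENNReal.rpow_mul]
  norm_num

lemma l2norm_add_le (μ : Measure α) {f g : α → ℝ≥0∞} (hf : Measurable f) (hg : Measurable g) :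
    l2norm μ (fun x => f x + g x) ≤ l2norm μ f + l2norm μ g := by
  have h := ENNReal.lintegral_Lp_add_le (μ := μ) hf.aemeasurable hg.aemeasurable
    (p := 2) (by norm_num)
  simpa [l2norm] using h

lemma l2norm_comp {β : Type*} [MeasurableSpace β] {μ : Measure α} {ν : Measure β} {φ : α → β}
    (hφ : MeasurePreserving φ μ ν) {f : β → ℝ≥0∞} (hf : Measurable f) :
    l2norm μ (fun x => f (φ x)) = l2norm ν f := by
  unfold l2norm
  rw [← hφ.lintegral_comp (hf.pow_const 2)]

/-- Monotone convergence for the `L²` norm, in the form in which a countable supremum is bounded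
through its finite subfamilies. -/
lemma l2norm_iSup_le [Countable ι] {μ : Measure α} {F : ι → α → ℝ≥0∞}
    (hF : ∀ i, Measurable (F i)) {c : ℝ≥0∞}
    (h : ∀ s : Finset ι, l2norm μ (fun x => ⨆ i ∈ s, F i x) ≤ c) :
    l2norm μ (fun x => ⨆ i, F i x) ≤ c := by
  classical
  apply l2norm_le_of_sq_le
  have hm : ∀ s : Finset ι, Measurable fun x => (⨆ i ∈ s, F i x) ^ 2 := fun s =>
    (Measurable.iSup fun i => Measurable.iSup fun _ => hF i).pow_const 2
  have hmono : Monotone fun (s : Finset ι) x => (⨆ i ∈ s, F i x) ^ 2 := by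
    intro s t hst x
    exact pow_le_pow_left' (biSup_mono fun i hi => hst hi) 2
  have e : ∀ x, (⨆ i, F i x) ^ 2 = ⨆ s : Finset ι, (⨆ i ∈ s, F i x) ^ 2 := by
    intro x
    rw [iSup_eq_iSup_finset]
    exact (pow_left_mono 2).map_iSup_of_continuousAt
      (ENNReal.continuous_pow 2).continuousAt (by simp)
  simp_rw [e]
  rw [lintegral_iSup_directed_of_measurable hm hmono.directed_le]
  refine iSup_le fun s => ?_
  rw [← l2norm_sq]
  exact pow_le_pow_left' (h s) 2

lemma ENNReal.le_of_sq_le_mul {x c : ℝ≥0∞} (hx : x ≠ ∞) (h : x ^ 2 ≤ c * x) : x ≤ c := by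
  rcases eq_or_ne x 0 with rfl | h0
  · simp
  · rw [sq] at h
    exact (ENNReal.mul_le_mul_iff_left h0 hx).1 h

lemma ENNReal.le_add_of_sq_le {x a b : ℝ≥0∞} (hx : x ≠ ∞) (h : x ^ 2 ≤ a ^ 2 + b * x) :
    x ≤ a + b := by
  rcases le_total x a with hxa | hxa
  · exact hxa.trans le_self_add
  · refine ENNReal.le_of_sq_le_mul hx (h.trans ?_)
    rw [add_mul, sq]
    gcongr

/-- The largest average of `f` over those sets of the finite family `P i`, `i ∈ s`, that contain
the given point. -/
noncomputable def maxAvg (μ : Measure α) (s : Finset ι) (P : ι → Set α) (f : α → ℝ≥0∞) (x : α) :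
    ℝ≥0∞ :=
  ⨆ i ∈ s, (P i).indicator (fun _ => (∫⁻ y in P i, f y ∂μ) / μ (P i)) x

/-- The adjoint side of the averages over `P i`: the masses `w i` spread evenly over the sets
`P i`. -/
noncomputable def spread (μ : Measure α) (s : Finset ι) (P : ι → Set α) (w : ι → ℝ≥0∞) (x : α) :
    ℝ≥0∞ :=
  ∑ i ∈ s, (P i).indicator (fun _ => w i / μ (P i)) x

/-- Disjoint measurable choices `E i ⊆ P i`, `i ∈ s`: on `E i` the average over `P i` is taken.
This linearizes the maximal average. -/
structure IsSelection (s : Finset ι) (P E : ι → Set α) : Prop where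
  meas : ∀ i ∈ s, MeasurableSet (E i)
  sub : ∀ i ∈ s, E i ⊆ P i
  disj : (s : Set ι).PairwiseDisjoint E

/-- The sets `P i`, `i ∈ s`, are measurable with positive finite measure. -/
structure IsAvgFamily (μ : Measure α) (s : Finset ι) (P : ι → Set α) : Prop where
  meas : ∀ i ∈ s, MeasurableSet (P i)
  ne_zero : ∀ i ∈ s, μ (P i) ≠ 0
  ne_top : ∀ i ∈ s, μ (P i) ≠ ∞

/-- The adjoint of every linearization of the maximal average over the family `P` has norm at most
`A` on `L²`. -/
def AdjointBound (μ : Measure α) (s : Finset ι) (P : ι → Set α) (A : ℝ≥0∞) : Prop :=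
  ∀ E, IsSelection s P E → ∀ g, Measurable g →
    l2norm μ (spread μ s P fun i => ∫⁻ x in E i, g x ∂μ) ≤ A * l2norm μ g

/-- The maximal average over the family `P` has norm at most `A` on `L²`. -/
def MaxBound (μ : Measure α) (s : Finset ι) (P : ι → Set α) (A : ℝ≥0∞) : Prop :=
  ∀ f, Measurable f → l2norm μ (maxAvg μ s P f) ≤ A * l2norm μ f

variable {μ : Measure α} {s : Finset ι} {P E : ι → Set α}

lemma IsAvgFamily.mono {t : Finset ι} (h : IsAvgFamily μ s P) (ht : t ⊆ s) :
    IsAvgFamily μ t P :=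
  ⟨fun i hi => h.meas i (ht hi), fun i hi => h.ne_zero i (ht hi), fun i hi => h.ne_top i (ht hi)⟩

lemma IsSelection.mono {t : Finset ι} (h : IsSelection s P E) (ht : t ⊆ s) :
    IsSelection t P E :=
  ⟨fun i hi => h.meas i (ht hi), fun i hi => h.sub i (ht hi),
    h.disj.subset (by exact_mod_cast ht)⟩

lemma IsSelection.enlarge {Q : ι → Set α} (h : IsSelection s P E) (hQ : ∀ i ∈ s, P i ⊆ Q i) :
    IsSelection s Q E :=
  ⟨h.meas, fun i hi => (h.sub i hi).trans (hQ i hi), h.disj⟩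

lemma measurable_maxAvg (hP : IsAvgFamily μ s P) (f : α → ℝ≥0∞) :
    Measurable (maxAvg μ s P f) :=
  Measurable.biSup _ s.countable_toSet fun i hi => measurable_const.indicator (hP.meas i hi)

lemma measurable_spread (hP : IsAvgFamily μ s P) (w : ι → ℝ≥0∞) :
    Measurable (spread μ s P w) :=
  Finset.measurable_fun_sum s fun i hi => measurable_const.indicator (hP.meas i hi)

lemma lintegral_mul_spread (hP : IsAvgFamily μ s P) (w : ι → ℝ≥0∞) {f : α → ℝ≥0∞}
    (hf : Measurable f) :
    ∫⁻ x, f x * spread μ s P w x ∂μ = ∑ i ∈ s, w i * ((∫⁻ x in P i, f x ∂μ) / μ (P i)) := by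
  simp only [spread, Finset.mul_sum]
  have hm : ∀ i ∈ s, AEMeasurable (fun x => f x * (P i).indicator (fun _ => w i / μ (P i)) x) μ :=
    fun i hi => (hf.mul (measurable_const.indicator (hP.meas i hi))).aemeasurable
  rw [lintegral_finsetSum' _ hm]
  refine Finset.sum_congr rfl fun i hi => ?_
  have : ∀ x, f x * (P i).indicator (fun _ => w i / μ (P i)) x =
      (P i).indicator (fun x => f x * (w i / μ (P i))) x := by
    intro x
    by_cases hx : x ∈ P i <;> simp [hx]
  simp_rw [this]
  rw [lintegral_indicator (hP.meas i hi), lintegral_mul_const _ hf]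
  simp only [div_eq_mul_inv]
  ring

lemma lintegral_spread_mul_spread {κ : Type*} {t : Finset κ} {Q : κ → Set α}
    (hP : IsAvgFamily μ s P) (hQ : IsAvgFamily μ t Q) (w : ι → ℝ≥0∞) (v : κ → ℝ≥0∞) :
    ∫⁻ x, spread μ s P w x * spread μ t Q v x ∂μ =
      ∑ i ∈ s, ∑ j ∈ t, w i * v j * (μ (P i ∩ Q j) / (μ (P i) * μ (Q j))) := by
  simp_rw [mul_comm (spread μ s P w _)]
  rw [lintegral_mul_spread hP w (measurable_spread hQ v)]
  refine Finset.sum_congr rfl fun i hi => ?_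
  have : ∫⁻ x in P i, spread μ t Q v x ∂μ = ∑ j ∈ t, v j / μ (Q j) * μ (P i ∩ Q j) := by
    simp only [spread]
    rw [lintegral_finsetSum' _ fun j hj =>
      (measurable_const.indicator (hQ.meas j hj)).aemeasurable]
    refine Finset.sum_congr rfl fun j hj => ?_
    rw [lintegral_indicator_const (hQ.meas j hj), Measure.restrict_apply (hQ.meas j hj),
      Set.inter_comm]
  rw [this]
  simp only [div_eq_mul_inv, Finset.sum_mul, Finset.mul_sum]
  refine Finset.sum_congr rfl fun j hj => ?_
  rw [ENNReal.mul_inv (.inl (hP.ne_zero i hi)) (.inl (hP.ne_top i hi))]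
  ring

lemma IsSelection.sum_setLIntegral_le (hE : IsSelection s P E) (g : α → ℝ≥0∞) {T : Set α}
    (hT : ∀ i ∈ s, E i ⊆ T) : ∑ i ∈ s, ∫⁻ x in E i, g x ∂μ ≤ ∫⁻ x in T, g x ∂μ := by
  rw [← lintegral_biUnion_finset hE.disj hE.meas]
  exact lintegral_mono_set (Set.iUnion₂_subset hT)

lemma setLIntegral_lt_top_of_l2norm {f : α → ℝ≥0∞} (hf : Measurable f) (hf2 : l2norm μ f ≠ ∞)
    {T : Set α} (hT : MeasurableSet T) (hμ : μ T ≠ ∞) : ∫⁻ x in T, f x ∂μ < ∞ := by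
  have h := lintegral_mul_le_l2norm μ (f := f) (g := T.indicator 1) hf.aemeasurable
    (measurable_one.indicator hT).aemeasurable
  have e1 : ∫⁻ x, f x * T.indicator 1 x ∂μ = ∫⁻ x in T, f x ∂μ := by
    rw [← lintegral_indicator hT]
    refine lintegral_congr fun x => ?_
    by_cases hx : x ∈ T <;> simp [hx]
  have e2 : l2norm μ (T.indicator 1) = μ T ^ (1 / 2 : ℝ) := by
    unfold l2norm
    congr 1
    rw [← lintegral_indicator_one hT]
    refine lintegral_congr fun x => ?_
    by_cases hx : x ∈ T <;> simp [hx]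
  rw [e1, e2] at h
  refine h.trans_lt (ENNReal.mul_lt_top hf2.lt_top (ENNReal.rpow_lt_top_of_nonneg (by norm_num) hμ))

lemma l2norm_spread_le (hP : IsAvgFamily μ s P) (w : ι → ℝ≥0∞) :
    l2norm μ (spread μ s P w) ≤ ∑ i ∈ s, w i / μ (P i) * μ (P i) ^ (1 / 2 : ℝ) := by
  classical
  induction s using Finset.induction_on with
  | empty => simp [l2norm, spread]
  | insert a s ha ih =>
    rw [Finset.sum_insert ha]
    have e : spread μ (insert a s) P w =
        fun x => (P a).indicator (fun _ => w a / μ (P a)) x + spread μ s P w x := by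
      funext x
      simp [spread, Finset.sum_insert ha]
    have hs := hP.mono (Finset.subset_insert a s)
    have ham := hP.meas a (Finset.mem_insert_self a s)
    rw [e]
    refine (l2norm_add_le μ (measurable_const.indicator ham) (measurable_spread hs w)).trans ?_
    refine add_le_add (le_of_eq ?_) (ih hs)
    have : ((P a).indicator fun _ => w a / μ (P a)) =
        fun x => w a / μ (P a) * (P a).indicator (fun _ => 1) x := by
      funext x
      by_cases hx : x ∈ P a <;> simp [hx]
    rw [this, l2norm_const_mul μ _ (measurable_const.indicator ham)]
    congr 1
    unfold l2norm
    congr 1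
    rw [← lintegral_indicator_one ham]
    refine lintegral_congr fun x => ?_
    by_cases hx : x ∈ P a <;> simp [hx]

lemma l2norm_spread_ne_top (hP : IsAvgFamily μ s P) {w : ι → ℝ≥0∞} (hw : ∀ i ∈ s, w i ≠ ∞) :
    l2norm μ (spread μ s P w) ≠ ∞ := by
  refine ((l2norm_spread_le hP w).trans_lt (ENNReal.sum_lt_top.2 fun i hi => ?_)).ne
  exact ENNReal.mul_lt_top (ENNReal.div_lt_top (hw i hi) (hP.ne_zero i hi))
    (ENNReal.rpow_lt_top_of_nonneg (by norm_num) (hP.ne_top i hi))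

lemma IsSelection.setLIntegral_ne_top (hP : IsAvgFamily μ s P) (hE : IsSelection s P E)
    {g : α → ℝ≥0∞} (hg : Measurable g) (hg2 : l2norm μ g ≠ ∞) :
    ∀ i ∈ s, ∫⁻ x in E i, g x ∂μ ≠ ∞ := fun i hi =>
  ((lintegral_mono_set (hE.sub i hi)).trans_lt
    (setLIntegral_lt_top_of_l2norm hg hg2 (hP.meas i hi) (hP.ne_top i hi))).ne

/-- Choosing at every point a set of the family that realizes the maximal average. -/
lemma exists_selection_maxAvg (hP : IsAvgFamily μ s P) (f : α → ℝ≥0∞) :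
    ∃ E, IsSelection s P E ∧ ∀ x, maxAvg μ s P f x ≤
      ∑ i ∈ s, (E i).indicator (fun _ => (∫⁻ y in P i, f y ∂μ) / μ (P i)) x := by
  classical
  induction s using Finset.induction_on with
  | empty => exact ⟨P, ⟨by simp, by simp, by simp⟩, by simp [maxAvg]⟩
  | insert a s ha ih =>
    have hs := hP.mono (Finset.subset_insert a s)
    have ham := hP.meas a (Finset.mem_insert_self a s)
    obtain ⟨E, hE, hmax⟩ := ih hs
    set c := (∫⁻ y in P a, f y ∂μ) / μ (P a) with hc
    -- the new set wins exactly where its average beats the old maximum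
    set W : Set α := P a ∩ {x | maxAvg μ s P f x < c} with hW
    have hWm : MeasurableSet W :=
      ham.inter (measurableSet_lt (measurable_maxAvg hs f) measurable_const)
    refine ⟨fun i => if i = a then W else E i \ W, ⟨?_, ?_, ?_⟩, ?_⟩
    · intro i hi
      by_cases h : i = a
      · simpa [h] using hWm
      · simpa [h] using (hE.meas i (Finset.mem_of_mem_insert_of_ne hi h)).diff hWm
    · intro i hi
      by_cases h : i = a
      · simp [h, hW]
      · simpa [h] using Set.sdiff_subset.trans (hE.sub i (Finset.mem_of_mem_insert_of_ne hi h))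
    · intro i hi j hj hij
      have hi' : i ∈ insert a s := hi
      have hj' : j ∈ insert a s := hj
      by_cases h : i = a
      · have h2 : j ≠ a := fun h2 => hij (h.trans h2.symm)
        simpa [Function.onFun, h, h2] using Set.disjoint_sdiff_right
      · by_cases h2 : j = a
        · simpa [Function.onFun, h, h2] using Set.disjoint_sdiff_left
        · simpa [Function.onFun, h, h2] using (hE.disj
            (Finset.mem_of_mem_insert_of_ne hi' h) (Finset.mem_of_mem_insert_of_ne hj' h2) hij).mono
            Set.sdiff_subset Set.sdiff_subset
    · intro x
      have e1 : maxAvg μ (insert a s) P f x =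
          (P a).indicator (fun _ => c) x ⊔ maxAvg μ s P f x := by
        simp only [maxAvg, hc]
        rw [Finset.iSup_insert]
      rw [Finset.sum_insert ha, e1]
      by_cases hx : x ∈ W
      · refine le_trans ?_ le_self_add
        simp only [if_true, Set.indicator_of_mem hx]
        refine sup_le ?_ hx.2.le
        rw [Set.indicator_of_mem hx.1]
      · have h1 : (P a).indicator (fun _ => c) x ≤ maxAvg μ s P f x := by
          by_cases hxa : x ∈ P a
          · rw [Set.indicator_of_mem hxa]
            exact not_lt.1 fun h => hx ⟨hxa, h⟩
          · simp [hxa]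
        rw [sup_eq_right.2 h1]
        refine (hmax x).trans (le_trans (le_of_eq ?_) le_add_self)
        refine Finset.sum_congr rfl fun i hi => ?_
        have : i ≠ a := fun h => ha (h ▸ hi)
        simp only [this, if_false]
        by_cases hxi : x ∈ E i
        · have hxW : x ∈ E i \ W := ⟨hxi, hx⟩
          rw [Set.indicator_of_mem hxi, Set.indicator_of_mem hxW]
        · rw [Set.indicator_of_notMem hxi, Set.indicator_of_notMem fun h => hxi h.1]

/-- A linearization of the maximal average, paired with `g`, is dominated by the maximal average. -/
lemma IsSelection.sum_mul_setLIntegral_le (hE : IsSelection s P E)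
    {g : α → ℝ≥0∞} (hg : Measurable g) (f : α → ℝ≥0∞) :
    ∑ i ∈ s, (∫⁻ x in E i, g x ∂μ) * ((∫⁻ x in P i, f x ∂μ) / μ (P i)) ≤
      ∫⁻ x, g x * maxAvg μ s P f x ∂μ := by
  refine le_trans ?_ (hE.sum_setLIntegral_le _ (T := Set.univ) (by simp) |>.trans_eq
    (by rw [Measure.restrict_univ]))
  refine Finset.sum_le_sum fun i hi => ?_
  rw [← lintegral_mul_const _ hg]
  refine setLIntegral_mono' (hE.meas i hi) fun x hx => ?_
  gcongr
  unfold maxAvg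
  refine le_trans (le_of_eq ?_) (le_iSup₂ i hi)
  rw [Set.indicator_of_mem (hE.sub i hi hx)]

lemma MaxBound.adjointBound (hP : IsAvgFamily μ s P) {A : ℝ≥0∞} (hA : A ≠ 0)
    (h : MaxBound μ s P A) : AdjointBound μ s P A := by
  intro E hE g hg
  rcases eq_or_ne (l2norm μ g) ∞ with hg2 | hg2
  · simp [hg2, ENNReal.mul_top hA]
  set S := spread μ s P fun i => ∫⁻ x in E i, g x ∂μ with hS
  have hSm : Measurable S := measurable_spread hP _
  have hS2 : l2norm μ S ≠ ∞ := l2norm_spread_ne_top hP (hE.setLIntegral_ne_top hP hg hg2)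
  refine ENNReal.le_of_sq_le_mul hS2 ?_
  calc l2norm μ S ^ 2 = ∫⁻ x, S x * S x ∂μ := by simp_rw [l2norm_sq, sq]
    _ = ∑ i ∈ s, (∫⁻ x in E i, g x ∂μ) * ((∫⁻ x in P i, S x ∂μ) / μ (P i)) :=
      lintegral_mul_spread hP _ hSm
    _ ≤ ∫⁻ x, g x * maxAvg μ s P S x ∂μ := hE.sum_mul_setLIntegral_le hg S
    _ ≤ l2norm μ g * l2norm μ (maxAvg μ s P S) :=
      lintegral_mul_le_l2norm μ hg.aemeasurable (measurable_maxAvg hP S).aemeasurable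
    _ ≤ l2norm μ g * (A * l2norm μ S) := by gcongr; exact h S hSm
    _ = A * l2norm μ g * l2norm μ S := by ring

lemma AdjointBound.maxBound (hP : IsAvgFamily μ s P) {A : ℝ≥0∞} (hA : A ≠ 0)
    (h : AdjointBound μ s P A) : MaxBound μ s P A := by
  intro f hf
  rcases eq_or_ne (l2norm μ f) ∞ with hf2 | hf2
  · simp [hf2, ENNReal.mul_top hA]
  have hfin : ∀ i ∈ s, ∫⁻ x in P i, f x ∂μ ≠ ∞ := fun i hi =>
    (setLIntegral_lt_top_of_l2norm hf hf2 (hP.meas i hi) (hP.ne_top i hi)).ne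
  set M := maxAvg μ s P f with hM
  have hMm : Measurable M := measurable_maxAvg hP f
  have hM2 : l2norm μ M ≠ ∞ := by
    refine ((l2norm_mono (g := spread μ s P fun i => ∫⁻ x in P i, f x ∂μ) ?_).trans_lt
      (l2norm_spread_ne_top hP hfin).lt_top).ne
    intro x
    refine iSup₂_le fun i hi => ?_
    exact Finset.single_le_sum
      (f := fun i => (P i).indicator (fun _ => (∫⁻ y in P i, f y ∂μ) / μ (P i)) x)
      (fun _ _ => zero_le) hi
  obtain ⟨E, hE, hmax⟩ := exists_selection_maxAvg hP f
  refine ENNReal.le_of_sq_le_mul hM2 ?_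
  calc l2norm μ M ^ 2 = ∫⁻ x, M x * M x ∂μ := by simp_rw [l2norm_sq, sq]
    _ ≤ ∫⁻ x, M x *
        ∑ i ∈ s, (E i).indicator (fun _ => (∫⁻ y in P i, f y ∂μ) / μ (P i)) x ∂μ := by
      gcongr with x
      exact hmax x
    _ = ∑ i ∈ s, (∫⁻ x in E i, M x ∂μ) * ((∫⁻ y in P i, f y ∂μ) / μ (P i)) := by
      simp only [Finset.mul_sum]
      have hm : ∀ i ∈ s, AEMeasurable (fun x => M x *
          (E i).indicator (fun _ => (∫⁻ y in P i, f y ∂μ) / μ (P i)) x) μ := fun i hi =>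
        (hMm.mul (measurable_const.indicator (hE.meas i hi))).aemeasurable
      rw [lintegral_finsetSum' _ hm]
      refine Finset.sum_congr rfl fun i hi => ?_
      rw [← lintegral_mul_const _ hMm, ← lintegral_indicator (hE.meas i hi)]
      refine lintegral_congr fun x => ?_
      by_cases hx : x ∈ E i <;> simp [hx]
    _ = ∫⁻ x, f x * spread μ s P (fun i => ∫⁻ x in E i, M x ∂μ) x ∂μ :=
      (lintegral_mul_spread hP _ hf).symm
    _ ≤ l2norm μ f * l2norm μ (spread μ s P fun i => ∫⁻ x in E i, M x ∂μ) :=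
      lintegral_mul_le_l2norm μ hf.aemeasurable (measurable_spread hP _).aemeasurable
    _ ≤ l2norm μ f * (A * l2norm μ M) := by gcongr; exact h E hE M hMm
    _ = A * l2norm μ f * l2norm μ M := by ring

end Averages

/-! ### Averages over intervals -/

section Intervals

open Metric

variable {ι : Type*} {s : Finset ι} {c r : ι → ℝ}

lemma isAvgFamily_closedBall (hr : ∀ i ∈ s, 0 < r i) :
    IsAvgFamily volume s fun i => closedBall (c i) (r i) where
  meas _ _ := isClosed_closedBall.measurableSet
  ne_zero i hi := (measure_closedBall_pos _ _ (hr i hi)).ne'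
  ne_top _ _ := measure_closedBall_lt_top.ne

open scoped Classical in
/-- Two intervals overlap only if the longer one, tripled, contains the shorter one. -/
lemma overlap_closedBall_le {a b p q : ℝ} (hp : 0 < p) (hpq : p ≤ q) :
    volume (closedBall a p ∩ closedBall b q) / (volume (closedBall a p) * volume (closedBall b q)) ≤
      if closedBall a p ⊆ closedBall b (3 * q) then 3 / volume (closedBall b (3 * q)) else 0 := by
  have hne : volume (closedBall a p) ≠ 0 := (measure_closedBall_pos _ _ hp).ne'
  have hnt : volume (closedBall a p) ≠ ∞ := measure_closedBall_lt_top.ne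
  split_ifs with h
  · have h3 : volume (closedBall b (3 * q)) = 3 * volume (closedBall b q) := by
      rw [Real.volume_closedBall, Real.volume_closedBall,
        show 2 * (3 * q) = 3 * (2 * q) by ring, ENNReal.ofReal_mul (by norm_num)]
      norm_num
    calc _ ≤ volume (closedBall a p) / (volume (closedBall a p) * volume (closedBall b q)) := by
          gcongr
          exact Set.inter_subset_left
      _ = 1 / volume (closedBall b q) := by
          simpa using ENNReal.mul_div_mul_left 1 (volume (closedBall b q)) hne hnt
      _ = 3 / volume (closedBall b (3 * q)) := by
          rw [h3]
          simpa using (ENNReal.mul_div_mul_left 1 (volume (closedBall b q))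
            (c := 3) (by norm_num) (by norm_num)).symm
  · have : closedBall a p ∩ closedBall b q = ∅ := by
      by_contra hne
      obtain ⟨x, hxa, hxb⟩ := Set.nonempty_iff_ne_empty.2 hne
      refine h fun y hy => ?_
      rw [mem_closedBall] at *
      have h1 := dist_triangle y a b
      have h2 := dist_triangle a x b
      rw [dist_comm a x] at h2
      linarith
    simp [this]

/-- The square of the norm of the spread masses is a double sum over pairs of intervals. Collecting
the pairs according to the longer interval and using that the chosen sets are disjoint, it is
bounded by pairing `g` with the masses spread over the tripled intervals. -/
lemma l2norm_spread_sq_le {E : ι → Set ℝ} (hr : ∀ i ∈ s, 0 < r i)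
    (hE : IsSelection s (fun i => closedBall (c i) (r i)) E) {g : ℝ → ℝ≥0∞} (hg : Measurable g) :
    l2norm volume (spread volume s (fun i => closedBall (c i) (r i))
        fun i => ∫⁻ x in E i, g x) ^ 2 ≤
      6 * l2norm volume g * l2norm volume (spread volume s
        (fun i => closedBall (c i) (3 * r i)) fun i => ∫⁻ x in E i, g x) := by
  classical
  have hP := isAvgFamily_closedBall (c := c) hr
  have hP3 := isAvgFamily_closedBall (c := c) (s := s) (r := fun i => 3 * r i)
    fun i hi => by have := hr i hi; positivity
  set w : ι → ℝ≥0∞ := fun i => ∫⁻ x in E i, g x with hw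
  set K : ι → ι → ℝ≥0∞ := fun i j =>
    if closedBall (c i) (r i) ⊆ closedBall (c j) (3 * r j) then
      3 / volume (closedBall (c j) (3 * r j)) else 0 with hK
  have hpair : ∀ i ∈ s, ∀ j ∈ s, volume (closedBall (c i) (r i) ∩ closedBall (c j) (r j)) /
      (volume (closedBall (c i) (r i)) * volume (closedBall (c j) (r j))) ≤ K i j + K j i := by
    intro i hi j hj
    rcases le_total (r i) (r j) with hij | hij
    · exact (overlap_closedBall_le (hr i hi) hij).trans le_self_add
    · rw [Set.inter_comm, mul_comm (volume (closedBall (c i) (r i)))]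
      exact (overlap_closedBall_le (hr j hj) hij).trans le_add_self
  have hsum : ∑ i ∈ s, ∑ j ∈ s, w i * w j * K i j ≤
      3 * (l2norm volume g * l2norm volume (spread volume s
        (fun i => closedBall (c i) (3 * r i)) w)) := by
    rw [Finset.sum_comm]
    calc ∑ j ∈ s, ∑ i ∈ s, w i * w j * K i j
        ≤ ∑ j ∈ s, 3 * (w j * ((∫⁻ x in closedBall (c j) (3 * r j), g x) /
            volume (closedBall (c j) (3 * r j)))) := by
          refine Finset.sum_le_sum fun j hj => ?_
          set t := s.filter fun i => closedBall (c i) (r i) ⊆ closedBall (c j) (3 * r j)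
          calc ∑ i ∈ s, w i * w j * K i j
              = (∑ i ∈ t, w i) * (w j * (3 / volume (closedBall (c j) (3 * r j)))) := by
                rw [Finset.sum_filter, Finset.sum_mul]
                refine Finset.sum_congr rfl fun i hi => ?_
                simp only [hK]
                split_ifs <;> ring
            _ ≤ (∫⁻ x in closedBall (c j) (3 * r j), g x) *
                  (w j * (3 / volume (closedBall (c j) (3 * r j)))) := by
                gcongr
                exact (hE.mono (Finset.filter_subset _ s)).sum_setLIntegral_le g fun i hi =>
                  (hE.sub i (Finset.mem_of_mem_filter i hi)).trans (Finset.mem_filter.1 hi).2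
            _ = _ := by simp only [div_eq_mul_inv]; ring
      _ = 3 * ∫⁻ x, g x * spread volume s (fun i => closedBall (c i) (3 * r i)) w x := by
          rw [lintegral_mul_spread hP3 w hg, Finset.mul_sum]
      _ ≤ _ := by
          gcongr
          exact lintegral_mul_le_l2norm _ hg.aemeasurable (measurable_spread hP3 w).aemeasurable
  rw [l2norm_sq]
  simp_rw [sq]
  rw [lintegral_spread_mul_spread hP hP]
  calc _ ≤ ∑ i ∈ s, ∑ j ∈ s, (w i * w j * K i j + w i * w j * K j i) := by
        refine Finset.sum_le_sum fun i hi => Finset.sum_le_sum fun j hj => ?_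
        rw [← mul_add]
        gcongr
        exact hpair i hi j hj
    _ = ∑ i ∈ s, ∑ j ∈ s, w i * w j * K i j + ∑ i ∈ s, ∑ j ∈ s, w i * w j * K i j := by
        simp only [Finset.sum_add_distrib]
        congr 1
        rw [Finset.sum_comm]
        simp only [mul_comm]
    _ ≤ _ := by
        refine (add_le_add hsum hsum).trans_eq ?_
        ring

/-- The `L²` bound for averages over intervals. Each member of the sequence of norms obtained by
repeatedly tripling the intervals is controlled by the geometric mean of `6 ‖g‖` and the next one,
and the sequence is bounded; hence all its members are at most `6 ‖g‖`. -/
lemma adjointBound_closedBall (hr : ∀ i ∈ s, 0 < r i) :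
    AdjointBound volume s (fun i => closedBall (c i) (r i)) 6 := by
  intro E hE g hg
  rcases eq_or_ne (l2norm volume g) ∞ with hg2 | hg2
  · simp [hg2]
  set w : ι → ℝ≥0∞ := fun i => ∫⁻ x in E i, g x with hw
  have hr3 : ∀ k : ℕ, ∀ i ∈ s, 0 < 3 ^ k * r i := fun k i hi => by
    have := hr i hi; positivity
  have hsub : ∀ k : ℕ, ∀ i ∈ s, closedBall (c i) (r i) ⊆ closedBall (c i) (3 ^ k * r i) :=
    fun k i hi => closedBall_subset_closedBall
      (le_mul_of_one_le_left (hr i hi).le (one_le_pow₀ (by norm_num)))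
  have hP := isAvgFamily_closedBall (c := c) hr
  have hw2 : ∀ i ∈ s, w i ≠ ∞ := hE.setLIntegral_ne_top hP hg hg2
  set a : ℕ → ℝ≥0∞ := fun k =>
    l2norm volume (spread volume s (fun i => closedBall (c i) (3 ^ k * r i)) w) with ha
  have hstep : ∀ k, a k ^ 2 ≤ 6 * l2norm volume g * a (k + 1) := by
    intro k
    have h := l2norm_spread_sq_le (hr3 k) (hE.enlarge (hsub k)) hg
    have e : ∀ i, 3 ^ (k + 1) * r i = 3 * (3 ^ k * r i) := fun i => by ring
    simp only [ha, e]
    exact h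
  -- the norms stay bounded since every tripling lowers the `L²` norm of each single term
  set D : ℝ≥0∞ := ∑ i ∈ s, w i / volume (closedBall (c i) (r i)) ^ (1 / 2 : ℝ) with hD
  have hDtop : D ≠ ∞ := by
    refine (ENNReal.sum_lt_top.2 fun i hi => ENNReal.div_lt_top (hw2 i hi) ?_).ne
    exact (ENNReal.rpow_pos (hP.ne_zero i hi).bot_lt (hP.ne_top i hi)).ne'
  have haD : ∀ k, a k ≤ D := by
    intro k
    refine (l2norm_spread_le (isAvgFamily_closedBall (hr3 k)) w).trans ?_
    refine Finset.sum_le_sum fun i hi => ?_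
    set m := volume (closedBall (c i) (3 ^ k * r i)) with hm
    have hm0 : m ≠ 0 := (isAvgFamily_closedBall (c := c) (hr3 k)).ne_zero i hi
    have hmt : m ≠ ∞ := (isAvgFamily_closedBall (c := c) (hr3 k)).ne_top i hi
    have e : w i / m * m ^ (1 / 2 : ℝ) = w i / m ^ (1 / 2 : ℝ) := by
      rw [div_eq_mul_inv, mul_assoc, div_eq_mul_inv (w i), ← ENNReal.rpow_neg_one,
        ← ENNReal.rpow_neg, ← ENNReal.rpow_add _ _ hm0 hmt]
      norm_num
    rw [e]
    have hle : volume (closedBall (c i) (r i)) ≤ m := measure_mono (hsub k i hi)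
    gcongr
  have hsup : ⨆ k, a k ≠ ∞ := ((iSup_le haD).trans_lt hDtop.lt_top).ne
  have hmain : ⨆ k, a k ≤ 6 * l2norm volume g := by
    refine ENNReal.le_of_sq_le_mul hsup ?_
    rw [ENNReal.iSup_pow]
    refine iSup_le fun k => (hstep k).trans ?_
    gcongr
    exact le_iSup a (k + 1)
  simpa [ha] using (le_iSup a 0).trans hmain

lemma maxBound_closedBall (hr : ∀ i ∈ s, 0 < r i) :
    MaxBound volume s (fun i => closedBall (c i) (r i)) 6 :=
  (adjointBound_closedBall hr).maxBound (isAvgFamily_closedBall hr) (by norm_num)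

end Intervals

/-! ### Averages over products and over parallelograms of one slope -/

section Products

variable {ι α β : Type*} [MeasurableSpace α] [MeasurableSpace β] {μ : Measure α} {ν : Measure β}
  {s : Finset ι} {I : ι → Set α} {J : ι → Set β}

lemma IsAvgFamily.prod [SFinite ν] (hI : IsAvgFamily μ s I) (hJ : IsAvgFamily ν s J) :
    IsAvgFamily (μ.prod ν) s fun i => I i ×ˢ J i where
  meas i hi := (hI.meas i hi).prod (hJ.meas i hi)
  ne_zero i hi := by
    rw [Measure.prod_prod]
    exact mul_ne_zero (hI.ne_zero i hi) (hJ.ne_zero i hi)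
  ne_top i hi := by
    rw [Measure.prod_prod]
    exact ENNReal.mul_ne_top (hI.ne_top i hi) (hJ.ne_top i hi)

lemma lintegral_sq_maxAvg_le {A : ℝ≥0∞} (h : MaxBound μ s I A) {f : α → ℝ≥0∞}
    (hf : Measurable f) : ∫⁻ x, maxAvg μ s I f x ^ 2 ∂μ ≤ A ^ 2 * ∫⁻ x, f x ^ 2 ∂μ := by
  rw [← l2norm_sq, ← l2norm_sq, ← mul_pow]
  exact pow_le_pow_left' (h f hf) 2

/-- The maximal average over product sets is dominated by iterated maximal averages in the two
variables. -/
lemma MaxBound.prod [SFinite μ] [SFinite ν] {A B : ℝ≥0∞} (hI : IsAvgFamily μ s I)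
    (hJ : IsAvgFamily ν s J) (hA : MaxBound μ s I A) (hB : MaxBound ν s J B) :
    MaxBound (μ.prod ν) s (fun i => I i ×ˢ J i) (A * B) := by
  intro f hf
  set F : α × β → ℝ≥0∞ := fun p => maxAvg ν s J (fun y => f (p.1, y)) p.2 with hF
  have hFm : Measurable F := by
    refine Measurable.biSup _ s.countable_toSet fun i hi => ?_
    have h1 : Measurable fun p : α × β => (∫⁻ y in J i, f (p.1, y) ∂ν) / ν (J i) :=
      (hf.lintegral_prod_right'.comp measurable_fst).div_const _
    exact h1.indicator (measurable_snd (hJ.meas i hi))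
  set G : α × β → ℝ≥0∞ := fun p => maxAvg μ s I (fun x => F (x, p.2)) p.1 with hG
  have hGm : Measurable G := by
    refine Measurable.biSup _ s.countable_toSet fun i hi => ?_
    have h1 : Measurable fun p : α × β => (∫⁻ x in I i, F (x, p.2) ∂μ) / μ (I i) :=
      (hFm.lintegral_prod_left'.comp measurable_snd).div_const _
    exact h1.indicator (measurable_fst (hI.meas i hi))
  have hle : ∀ p, maxAvg (μ.prod ν) s (fun i => I i ×ˢ J i) f p ≤ G p := by
    intro p
    refine iSup₂_le fun i hi => ?_
    by_cases hp : p ∈ I i ×ˢ J i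
    · rw [Set.indicator_of_mem hp]
      refine le_trans ?_ (le_iSup₂ (f := fun i _ => (I i).indicator
        (fun _ => (∫⁻ x in I i, F (x, p.2) ∂μ) / μ (I i)) p.1) i hi)
      rw [Set.indicator_of_mem hp.1, Measure.prod_prod, ← Measure.prod_restrict,
        lintegral_prod _ hf.aemeasurable]
      calc (∫⁻ x in I i, ∫⁻ y in J i, f (x, y) ∂ν ∂μ) / (μ (I i) * ν (J i))
          = (∫⁻ x in I i, (∫⁻ y in J i, f (x, y) ∂ν) / ν (J i) ∂μ) / μ (I i) := by
            simp only [div_eq_mul_inv]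
            rw [lintegral_mul_const _ hf.lintegral_prod_right',
              ENNReal.mul_inv (.inl (hI.ne_zero i hi)) (.inl (hI.ne_top i hi))]
            ring
        _ ≤ (∫⁻ x in I i, F (x, p.2) ∂μ) / μ (I i) := by
            gcongr with x
            refine le_trans (le_of_eq ?_) (le_iSup₂ (f := fun i _ => (J i).indicator
              (fun _ => (∫⁻ y in J i, f (x, y) ∂ν) / ν (J i)) p.2) i hi)
            rw [Set.indicator_of_mem hp.2]
    · rw [Set.indicator_of_notMem hp]
      exact zero_le
  refine (l2norm_mono hle).trans (l2norm_le_of_sq_le ?_)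
  calc ∫⁻ p, G p ^ 2 ∂(μ.prod ν)
      = ∫⁻ y, ∫⁻ x, G (x, y) ^ 2 ∂μ ∂ν := lintegral_prod_symm' (fun p => G p ^ 2) (hGm.pow_const 2)
    _ ≤ ∫⁻ y, A ^ 2 * ∫⁻ x, F (x, y) ^ 2 ∂μ ∂ν :=
        lintegral_mono fun y => lintegral_sq_maxAvg_le (f := fun x => F (x, y)) hA
          (hFm.comp measurable_prodMk_right)
    _ = A ^ 2 * ∫⁻ x, ∫⁻ y, F (x, y) ^ 2 ∂ν ∂μ := by
        rw [lintegral_const_mul _ (hFm.pow_const 2).lintegral_prod_left',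
          ← lintegral_prod_symm' (fun p => F p ^ 2) (hFm.pow_const 2),
          lintegral_prod _ (hFm.pow_const 2).aemeasurable]
    _ ≤ A ^ 2 * ∫⁻ x, B ^ 2 * ∫⁻ y, f (x, y) ^ 2 ∂ν ∂μ := by
        refine mul_le_mul_right (lintegral_mono fun x => ?_) _
        exact lintegral_sq_maxAvg_le (f := fun y => f (x, y)) hB (hf.comp measurable_prodMk_left)
    _ = (A * B * l2norm (μ.prod ν) f) ^ 2 := by
        rw [lintegral_const_mul _ (hf.pow_const 2).lintegral_prod_right', mul_pow, l2norm_sq,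
          lintegral_prod _ (hf.pow_const 2).aemeasurable]
        ring

lemma MaxBound.preimage {P : ι → Set β} {A : ℝ≥0∞} (e : α ≃ᵐ β) (he : MeasurePreserving e μ ν)
    (hP : IsAvgFamily ν s P) (h : MaxBound ν s P A) :
    MaxBound μ s (fun i => e ⁻¹' P i) A := by
  intro f hf
  have hf' : Measurable fun y => f (e.symm y) := hf.comp e.symm.measurable
  have e1 : maxAvg μ s (fun i => e ⁻¹' P i) f =
      fun x => maxAvg ν s P (fun y => f (e.symm y)) (e x) := by
    funext x
    unfold maxAvg
    refine iSup_congr fun i => iSup_congr fun _ => ?_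
    rw [he.measure_preimage_equiv, ← he.setLIntegral_comp_preimage_emb e.measurableEmbedding]
    simp only [Set.indicator, Set.mem_preimage, MeasurableEquiv.symm_apply_apply]
    congr
  rw [e1, l2norm_comp he (measurable_maxAvg hP _)]
  refine (h _ hf').trans_eq ?_
  rw [← l2norm_comp he hf']
  simp

end Products

/-- The parallelogram with two vertical sides and two sides of slope `m`: center `(a, c)`, half
the width `l`, half the height of the vertical sections `h`. -/
def par (m a c l h : ℝ) : Set (ℝ × ℝ) :=
  {p | |p.1 - a| ≤ l ∧ |p.2 - (m * (p.1 - a) + c)| ≤ h}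

/-- The shear of the plane that makes lines of slope `m` horizontal. -/
def shear (m : ℝ) : ℝ × ℝ ≃ᵐ ℝ × ℝ where
  toFun p := (p.1, p.2 - m * p.1)
  invFun p := (p.1, p.2 + m * p.1)
  left_inv p := by simp
  right_inv p := by simp
  measurable_toFun := by simp only [Equiv.coe_fn_mk]; fun_prop
  measurable_invFun := by simp only [Equiv.coe_fn_symm_mk]; fun_prop

lemma measurePreserving_shear (m : ℝ) : MeasurePreserving (shear m) volume volume := by
  refine (MeasurePreserving.id volume).skew_product (g := fun x y => y - m * x)
    (by fun_prop) (Filter.Eventually.of_forall fun x => ?_)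
  exact (measurePreserving_sub_right volume (m * x)).map_eq

lemma par_eq_preimage (m a c l h : ℝ) :
    par m a c l h = shear m ⁻¹' (Metric.closedBall a l ×ˢ Metric.closedBall (c - m * a) h) := by
  ext p
  simp only [par, shear, Set.mem_ofPred_eq, Set.mem_preimage, MeasurableEquiv.coe_mk,
    Equiv.coe_fn_mk, Set.mem_prod, Metric.mem_closedBall, Real.dist_eq]
  rw [show p.2 - (m * (p.1 - a) + c) = p.2 - m * p.1 - (c - m * a) by ring]

lemma volume_par (m a c l h : ℝ) (hl : 0 ≤ l) :
    volume (par m a c l h) = ENNReal.ofReal (4 * l * h) := by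
  rw [par_eq_preimage, (measurePreserving_shear m).measure_preimage_equiv, Measure.volume_eq_prod,
    Measure.prod_prod, Real.volume_closedBall, Real.volume_closedBall,
    ← ENNReal.ofReal_mul (by positivity)]
  congr 1
  ring

section OneSlope

variable {ι : Type*} {s : Finset ι} {m a c l h : ι → ℝ}

lemma isAvgFamily_par (hl : ∀ i ∈ s, 0 < l i) (hh : ∀ i ∈ s, 0 < h i) :
    IsAvgFamily volume s fun i => par (m i) (a i) (c i) (l i) (h i) where
  meas i hi := by
    rw [par_eq_preimage]
    exact (shear _).measurable
      (Metric.isClosed_closedBall.measurableSet.prod Metric.isClosed_closedBall.measurableSet)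
  ne_zero i hi := by
    have := hl i hi
    have := hh i hi
    rw [volume_par _ _ _ _ _ (hl i hi).le]
    simp only [ne_eq, ENNReal.ofReal_eq_zero, not_le]
    positivity
  ne_top i hi := by
    rw [volume_par _ _ _ _ _ (hl i hi).le]
    exact ENNReal.ofReal_ne_top

/-- The strong maximal theorem on `L²`, in sheared coordinates. -/
lemma adjointBound_par_of_slope (m₀ : ℝ) (hl : ∀ i ∈ s, 0 < l i) (hh : ∀ i ∈ s, 0 < h i) :
    AdjointBound volume s (fun i => par m₀ (a i) (c i) (l i) (h i)) 36 := by
  refine MaxBound.adjointBound (isAvgFamily_par hl hh) (by norm_num) ?_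
  have hI := isAvgFamily_closedBall (c := a) hl
  have hJ := isAvgFamily_closedBall (c := fun i => c i - m₀ * a i) hh
  have h1 := (maxBound_closedBall hl).prod hI hJ (maxBound_closedBall hh)
  rw [show (6 : ℝ≥0∞) * 6 = 36 by norm_num] at h1
  simp_rw [par_eq_preimage]
  exact h1.preimage (shear m₀) (measurePreserving_shear m₀) (hI.prod hJ)

end OneSlope

/-! ### Overlaps of parallelograms of different slopes -/

section Overlap

/-- A strip-like set over `X` whose vertical sections are intervals of length `2 w`. -/
lemma volume_sections {X : Set ℝ} (hX : MeasurableSet X) {φ : ℝ → ℝ} (hφ : Measurable φ) (w : ℝ) :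
    volume {p : ℝ × ℝ | p.1 ∈ X ∧ |p.2 - φ p.1| ≤ w} = volume X * ENNReal.ofReal (2 * w) := by
  have hm : MeasurableSet {p : ℝ × ℝ | p.1 ∈ X ∧ |p.2 - φ p.1| ≤ w} := by
    have h1 : Measurable fun p : ℝ × ℝ => |p.2 - φ p.1| :=
      (measurable_snd.sub (hφ.comp measurable_fst)).abs
    exact (measurable_fst hX).inter (measurableSet_le h1 measurable_const)
  rw [Measure.volume_eq_prod, Measure.prod_apply hm, mul_comm, ← lintegral_indicator_const hX]
  refine lintegral_congr fun x => ?_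
  by_cases hx : x ∈ X
  · rw [Set.indicator_of_mem hx, ← Real.volume_closedBall (φ x)]
    congr 1
    ext y
    simp [hx, Real.dist_eq]
  · simp [hx]

/-- The set of abscissas at which the vertical sections of the two parallelograms meet. -/
def overlapBase (m a c l h m' a' c' l' h' : ℝ) : Set ℝ :=
  {x | |x - a| ≤ l ∧ |x - a'| ≤ l' ∧ |m * (x - a) + c - (m' * (x - a') + c')| ≤ h + h'}

variable {m a c l h m' a' c' l' h' : ℝ}

lemma measurableSet_overlapBase : MeasurableSet (overlapBase m a c l h m' a' c' l' h') := by
  have h1 : Continuous fun x : ℝ => |x - a| := by fun_prop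
  have h2 : Continuous fun x : ℝ => |x - a'| := by fun_prop
  have h3 : Continuous fun x : ℝ => |m * (x - a) + c - (m' * (x - a') + c')| := by fun_prop
  exact (measurableSet_le h1.measurable measurable_const).inter
    ((measurableSet_le h2.measurable measurable_const).inter
      (measurableSet_le h3.measurable measurable_const))

lemma volume_par_inter_le : volume (par m a c l h ∩ par m' a' c' l' h') ≤
    volume (overlapBase m a c l h m' a' c' l' h') * ENNReal.ofReal (2 * min h h') := by
  have hX := measurableSet_overlapBase (m := m) (a := a) (c := c) (l := l) (h := h) (m' := m')
    (a' := a') (c' := c') (l' := l') (h' := h')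
  have key : ∀ p ∈ par m a c l h ∩ par m' a' c' l' h',
      p.1 ∈ overlapBase m a c l h m' a' c' l' h' := by
    rintro p ⟨⟨h1, h2⟩, h3, h4⟩
    refine ⟨h1, h3, ?_⟩
    rw [abs_le] at *
    constructor <;> linarith
  rcases min_choice h h' with hh | hh <;> rw [hh]
  · rw [← volume_sections hX (φ := fun x => m * (x - a) + c) (by fun_prop)]
    exact measure_mono fun p hp => ⟨key p hp, hp.1.2⟩
  · rw [← volume_sections hX (φ := fun x => m' * (x - a') + c') (by fun_prop)]
    exact measure_mono fun p hp => ⟨key p hp, hp.2.2⟩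

lemma volume_overlapBase_le (hδ : 0 < |m - m'|) :
    volume (overlapBase m a c l h m' a' c' l' h') ≤ ENNReal.ofReal (2 * ((h + h') / |m - m'|)) := by
  have hne : m - m' ≠ 0 := abs_pos.1 hδ
  set z := (m * a - c - (m' * a' - c')) / (m - m') with hz
  rw [← Real.volume_closedBall z]
  refine measure_mono fun x hx => ?_
  rw [Metric.mem_closedBall, Real.dist_eq, le_div_iff₀ hδ, ← abs_mul]
  have : (x - z) * (m - m') = m * (x - a) + c - (m' * (x - a') + c') := by
    rw [hz, sub_mul, div_mul_cancel₀ _ hne]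
    ring
  rw [this]
  exact hx.2.2

/-- The parallelogram of slope `m₀` containing `par m a c l h`, with room to spare. -/
def tiltPar (m₀ m a c l h : ℝ) : Set (ℝ × ℝ) :=
  par m₀ a c (3 * l) (4 * (h + |m - m₀| * l))

lemma abs_slope_le {m₀ x : ℝ} {r : ℝ} (hx : |x - a| ≤ r) :
    |m * (x - a) - m₀ * (x - a)| ≤ |m - m₀| * r := by
  rw [← sub_mul, abs_mul]
  gcongr

lemma par_subset_tiltPar {m₀ : ℝ} (hl : 0 < l) (hh : 0 < h) :
    par m a c l h ⊆ tiltPar m₀ m a c l h := by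
  rintro p ⟨h1, h2⟩
  have h3 := abs_slope_le (m := m) (m₀ := m₀) h1
  have h4 : 0 ≤ |m - m₀| * l := by positivity
  refine ⟨by linarith, ?_⟩
  rw [abs_le] at *
  constructor <;> linarith

/-- If `m₀` lies between the slopes of two parallelograms, the first of which is the shorter one,
then tilting the first one to slope `m₀` loses at most a constant factor in the relative overlap. -/
lemma overlap_le_overlap_tiltPar {m₀ : ℝ} (hl : 0 < l) (hh : 0 < h) (hh' : 0 < h') (hll : l ≤ l')
    (hm : |m - m'| = |m - m₀| + |m₀ - m'|) :
    volume (par m a c l h ∩ par m' a' c' l' h') * ENNReal.ofReal (h + |m - m₀| * l) ≤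
      8 * volume (tiltPar m₀ m a c l h ∩ par m' a' c' l' h') * ENNReal.ofReal h := by
  set H := h + |m - m₀| * l with hH
  have hdl : 0 ≤ |m - m₀| * l := by positivity
  have hHpos : 0 < H := by positivity
  have hHh : h ≤ H := by linarith
  set X := overlapBase m a c l h m' a' c' l' h' with hXdef
  have hX : MeasurableSet X := measurableSet_overlapBase
  set τ := volume X with hτ
  have hup : volume (par m a c l h ∩ par m' a' c' l' h') ≤ τ * ENNReal.ofReal (2 * min h h') :=
    volume_par_inter_le
  -- it suffices to find enough of `par m' a' c' l' h'` inside the tilted parallelogram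
  suffices hlow : ∃ V, τ * ENNReal.ofReal (2 * min h h' * H) ≤ V * ENNReal.ofReal (8 * h) ∧
      V ≤ volume (tiltPar m₀ m a c l h ∩ par m' a' c' l' h') by
    obtain ⟨V, hV1, hV2⟩ := hlow
    calc _ ≤ τ * ENNReal.ofReal (2 * min h h') * ENNReal.ofReal H := by gcongr
      _ = τ * ENNReal.ofReal (2 * min h h' * H) := by
        rw [mul_assoc, ← ENNReal.ofReal_mul (by positivity)]
      _ ≤ V * ENNReal.ofReal (8 * h) := hV1
      _ ≤ volume (tiltPar m₀ m a c l h ∩ par m' a' c' l' h') * ENNReal.ofReal (8 * h) := by gcongr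
      _ = _ := by
        rw [ENNReal.ofReal_mul (by norm_num)]
        norm_num
        ring
  rcases le_or_gt H h' with hcase | hcase
  · -- over `X`, the long sections of the second parallelogram contain pieces of length `H`
    -- that stay close to the first one
    -- their centers are those of the first parallelogram, clamped to the admissible range
    set φ : ℝ → ℝ := fun x => max (m' * (x - a') + c' - (h' - H / 2))
      (min (m * (x - a) + c) (m' * (x - a') + c' + (h' - H / 2))) with hφ
    refine ⟨τ * ENNReal.ofReal (2 * (H / 2)), ?_, ?_⟩
    · rw [mul_assoc τ, ← ENNReal.ofReal_mul (by positivity), min_eq_left (hHh.trans hcase)]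
      refine mul_le_mul_right (ENNReal.ofReal_le_ofReal ?_) _
      nlinarith
    · rw [hτ, ← volume_sections hX (φ := φ) (by fun_prop)]
      refine measure_mono ?_
      rintro p ⟨⟨h1, h2, h3⟩, h4⟩
      have h5 := abs_slope_le (m := m) (m₀ := m₀) h1
      set u := m * (p.1 - a) + c
      set v := m' * (p.1 - a') + c'
      have h6 : |φ p.1 - v| ≤ h' - H / 2 := by
        have e1 : v - (h' - H / 2) ≤ φ p.1 := le_max_left _ _
        have e2 : φ p.1 ≤ v + (h' - H / 2) := max_le (by linarith) (min_le_right _ _)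
        rw [abs_le]
        constructor <;> linarith
      have h7 : |φ p.1 - u| ≤ h + H / 2 := by
        rw [abs_le] at h3
        have e1 : φ p.1 ≤ u + (h + H / 2) :=
          max_le (by linarith) ((min_le_left _ _).trans (by linarith))
        have e2 : u - (h + H / 2) ≤ φ p.1 :=
          le_max_of_le_right (le_min (by linarith) (by linarith))
        rw [abs_le]
        constructor <;> linarith
      refine ⟨⟨by linarith, ?_⟩, h2, ?_⟩
      · rw [abs_le] at *
        constructor <;> linarith
      · rw [abs_le] at *
        constructor <;> linarith
  · -- now whole vertical sections of the second parallelogram fit into the tilted one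
    rcases le_or_gt H (2 * h) with hcase2 | hcase2
    · refine ⟨τ * ENNReal.ofReal (2 * h'), ?_, ?_⟩
      · rw [mul_assoc τ, ← ENNReal.ofReal_mul (by positivity)]
        refine mul_le_mul_right (ENNReal.ofReal_le_ofReal ?_) _
        have e1 : min h h' * H ≤ h' * (2 * h) := by
          gcongr
          exact min_le_right _ _
        nlinarith [mul_pos hh hh']
      · rw [hτ, ← volume_sections hX (φ := fun x => m' * (x - a') + c') (by fun_prop)]
        refine measure_mono ?_
        rintro p ⟨⟨h1, h2, h3⟩, h4⟩
        have h5 := abs_slope_le (m := m) (m₀ := m₀) h1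
        refine ⟨⟨by linarith, ?_⟩, h2, h4⟩
        rw [abs_le] at *
        constructor <;> linarith
    · rcases Set.eq_empty_or_nonempty X with hXe | ⟨x₀, hx₀⟩
      · exact ⟨0, by simp [hτ, hXe], zero_le⟩
      obtain ⟨h1, h2, h3⟩ := hx₀
      have hd : 0 < |m - m₀| := by
        by_contra hd
        have : |m - m₀| = 0 := le_antisymm (not_lt.1 hd) (abs_nonneg _)
        rw [this] at hH
        linarith
      have hδ : 0 < |m - m'| := by rw [hm]; positivity
      have he : |m₀ - m'| ≤ |m - m'| := by rw [hm]; linarith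
      -- the transversal line needs abscissas of this length to leave the tilted parallelogram
      set r := H / (2 * |m - m'|) with hr
      have hrpos : 0 < r := by positivity
      have hrδ : |m - m'| * r = H / 2 := by rw [hr]; field_simp
      have hrl : r ≤ l := by
        rw [hr, div_le_iff₀ (by positivity)]
        have : |m - m₀| * l ≤ |m - m'| * l :=
          mul_le_mul_of_nonneg_right (by rw [hm]; linarith [abs_nonneg (m₀ - m')]) hl.le
        nlinarith
      have her : |m₀ - m'| * r ≤ H / 2 := by rw [← hrδ]; gcongr
      -- an interval of length `r` next to `x₀` inside the base of the second parallelogram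
      obtain ⟨y, hy1, hy2⟩ : ∃ y, (∀ x, |x - y| ≤ r / 2 → |x - x₀| ≤ r) ∧
          (∀ x, |x - y| ≤ r / 2 → |x - a'| ≤ l') := by
        rcases le_total x₀ a' with hxa | hxa
        · refine ⟨x₀ + r / 2, fun x hx => ?_, fun x hx => ?_⟩ <;>
          · rw [abs_le] at *
            constructor <;> linarith
        · refine ⟨x₀ - r / 2, fun x hx => ?_, fun x hx => ?_⟩ <;>
          · rw [abs_le] at *
            constructor <;> linarith
      refine ⟨volume (Metric.closedBall y (r / 2)) * ENNReal.ofReal (2 * h'), ?_, ?_⟩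
      · calc τ * ENNReal.ofReal (2 * min h h' * H)
            ≤ ENNReal.ofReal (2 * ((h + h') / |m - m'|)) * ENNReal.ofReal (2 * min h h' * H) := by
              gcongr
              exact volume_overlapBase_le hδ
          _ ≤ _ := by
              rw [Real.volume_closedBall, ← ENNReal.ofReal_mul (by positivity),
                ← ENNReal.ofReal_mul (by positivity), ← ENNReal.ofReal_mul (by positivity)]
              refine ENNReal.ofReal_le_ofReal ?_
              have e1 : (h + h') * min h h' ≤ 2 * (h * h') := by
                rcases le_total h h' with hle | hle
                · rw [min_eq_left hle]; nlinarith
                · rw [min_eq_right hle]; nlinarith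
              have e2 : 2 * ((h + h') / |m - m'|) * (2 * min h h' * H) =
                  (h + h') * min h h' * (8 * r) := by
                rw [hr]; field_simp; ring
              rw [e2]
              calc (h + h') * min h h' * (8 * r) ≤ 2 * (h * h') * (8 * r) := by gcongr
                _ = _ := by ring
      · rw [← volume_sections Metric.isClosed_closedBall.measurableSet
          (φ := fun x => m' * (x - a') + c') (by fun_prop)]
        refine measure_mono ?_
        rintro p ⟨hp, h4⟩
        rw [Metric.mem_closedBall, Real.dist_eq] at hp
        have h5 := abs_slope_le (m := m) (m₀ := m₀) h1
        have h6 := hy1 _ hp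
        have h7 : |m₀ * (p.1 - x₀) - m' * (p.1 - x₀)| ≤ |m₀ - m'| * r := abs_slope_le h6
        refine ⟨⟨?_, ?_⟩, hy2 _ hp, h4⟩
        · rw [abs_le] at *
          constructor <;> linarith
        · rw [abs_le] at *
          constructor <;> linarith

/-- The relative overlap of two parallelograms on different sides of the slope `m₀` is controlled
by the relative overlaps with one of them tilted to slope `m₀`. -/
lemma rel_overlap_le {m₀ : ℝ} (hl : 0 < l) (hh : 0 < h) (hh' : 0 < h') (hll : l ≤ l')
    (hm : |m - m'| = |m - m₀| + |m₀ - m'|) :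
    volume (par m a c l h ∩ par m' a' c' l' h') /
        (volume (par m a c l h) * volume (par m' a' c' l' h')) ≤
      96 * (volume (tiltPar m₀ m a c l h ∩ par m' a' c' l' h') /
        (volume (tiltPar m₀ m a c l h) * volume (par m' a' c' l' h'))) := by
  have hmain := overlap_le_overlap_tiltPar (a := a) (c := c) (a' := a') (c' := c') (h' := h')
    hl hh hh' hll hm
  set H := h + |m - m₀| * l with hH
  have hdl : 0 ≤ |m - m₀| * l := by positivity
  have hHpos : 0 < H := by positivity
  have e1 : volume (par m a c l h) = ENNReal.ofReal (4 * l) * ENNReal.ofReal h := by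
    rw [volume_par _ _ _ _ _ hl.le, ENNReal.ofReal_mul (by positivity)]
  have e2 : volume (tiltPar m₀ m a c l h) = 12 * (ENNReal.ofReal (4 * l) * ENNReal.ofReal H) := by
    rw [tiltPar, volume_par _ _ _ _ _ (by positivity), ← hH,
      show 4 * (3 * l) * (4 * H) = 12 * (4 * l * H) by ring, ENNReal.ofReal_mul (by norm_num),
      ENNReal.ofReal_mul (by positivity)]
    norm_num
  have p1 : ENNReal.ofReal h ≠ 0 := by simpa using hh
  have p2 : ENNReal.ofReal H ≠ 0 := by simpa using hHpos
  have p3 : ENNReal.ofReal (4 * l) ≠ 0 := by simpa using hl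
  set V := volume (par m' a' c' l' h')
  set U := volume (par m a c l h ∩ par m' a' c' l' h')
  set W := volume (tiltPar m₀ m a c l h ∩ par m' a' c' l' h')
  have hUW : U / ENNReal.ofReal h ≤ 8 * W / ENNReal.ofReal H := by
    rw [ENNReal.div_le_iff p1 ENNReal.ofReal_ne_top]
    rw [← ENNReal.le_div_iff_mul_le (.inl p2) (.inl ENNReal.ofReal_ne_top)] at hmain
    refine hmain.trans_eq ?_
    simp only [div_eq_mul_inv]
    ring
  have e3 : (12 : ℝ≥0∞)⁻¹ * 96 = 8 := by
    rw [show (96 : ℝ≥0∞) = 12 * 8 by norm_num, ← mul_assoc,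
      ENNReal.inv_mul_cancel (by norm_num) (by norm_num), one_mul]
  rw [e1, e2]
  calc U / (ENNReal.ofReal (4 * l) * ENNReal.ofReal h * V)
      = U / ENNReal.ofReal h * (ENNReal.ofReal (4 * l))⁻¹ * V⁻¹ := by
        rw [div_eq_mul_inv, ENNReal.mul_inv (.inl (mul_ne_zero p3 p1))
          (.inl (ENNReal.mul_ne_top ENNReal.ofReal_ne_top ENNReal.ofReal_ne_top)),
          ENNReal.mul_inv (.inl p3) (.inl ENNReal.ofReal_ne_top), div_eq_mul_inv]
        ring
    _ ≤ 8 * W / ENNReal.ofReal H * (ENNReal.ofReal (4 * l))⁻¹ * V⁻¹ := by gcongr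
    _ = (12 : ℝ≥0∞)⁻¹ * 96 * W / ENNReal.ofReal H * (ENNReal.ofReal (4 * l))⁻¹ * V⁻¹ := by rw [e3]
    _ = _ := by
        have p4 := mul_ne_zero p3 p2
        have p5 := ENNReal.mul_ne_top (ENNReal.ofReal_ne_top (r := 4 * l))
          (ENNReal.ofReal_ne_top (r := H))
        rw [div_eq_mul_inv _ (12 * (ENNReal.ofReal (4 * l) * ENNReal.ofReal H) * V),
          ENNReal.mul_inv (.inl (mul_ne_zero (by norm_num) p4))
          (.inl (ENNReal.mul_ne_top (by norm_num) p5)),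
          ENNReal.mul_inv (.inl (by norm_num)) (.inl (by norm_num)),
          ENNReal.mul_inv (.inl p3) (.inl ENNReal.ofReal_ne_top), div_eq_mul_inv]
        ring

end Overlap

/-! ### Adding up slopes -/

section Slopes

lemma Finset.exists_card_filter_le_eq (S : Finset ℝ) {n : ℕ} (hn : 1 ≤ n) (hS : n ≤ S.card) :
    ∃ m₀ ∈ S, (S.filter (· ≤ m₀)).card = n := by
  induction S using Finset.induction_on_max with
  | empty => simp at hS; omega
  | insert b S hb ih =>
    have hbS : b ∉ S := fun h => lt_irrefl b (hb b h)
    rw [Finset.card_insert_of_notMem hbS] at hS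
    rcases Nat.lt_or_ge S.card n with h | h
    · refine ⟨b, Finset.mem_insert_self b S, ?_⟩
      rw [Finset.filter_true_of_mem, Finset.card_insert_of_notMem hbS]
      · omega
      · intro x hx
        rcases Finset.mem_insert.1 hx with rfl | hx
        · exact le_rfl
        · exact (hb x hx).le
    · obtain ⟨m₀, hm, hc⟩ := ih h
      refine ⟨m₀, Finset.mem_insert_of_mem hm, ?_⟩
      rw [Finset.filter_insert, if_neg (hb m₀ hm).not_ge, hc]

/-- A finite set of at most `2 n` reals is cut by some point into two sets of at most `n` reals. -/
lemma Finset.exists_cut (S : Finset ℝ) {n : ℕ} (hn : 1 ≤ n) (hS : S.card ≤ 2 * n) :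
    ∃ m₀, (S.filter (· ≤ m₀)).card ≤ n ∧ (S.filter (m₀ < ·)).card ≤ n := by
  rcases le_or_gt S.card n with h | h
  · rcases S.eq_empty_or_nonempty with rfl | hne
    · exact ⟨0, by simp⟩
    · refine ⟨S.max' hne, (Finset.card_filter_le _ _).trans h, ?_⟩
      rw [Finset.filter_false_of_mem fun x hx => (S.le_max' x hx).not_gt]
      simp
  · obtain ⟨m₀, -, hc⟩ := S.exists_card_filter_le_eq hn h.le
    refine ⟨m₀, hc.le, ?_⟩
    have := S.card_filter_add_card_filter_not (· ≤ m₀)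
    simp only [not_le] at this
    omega

lemma AdjointBound.lintegral_sq_le {α ι : Type*} [MeasurableSpace α] {μ : Measure α}
    {s : Finset ι} {P E : ι → Set α} {A : ℝ≥0∞} (h : AdjointBound μ s P A)
    (hE : IsSelection s P E) {g : α → ℝ≥0∞} (hg : Measurable g) :
    ∫⁻ x, spread μ s P (fun i => ∫⁻ x in E i, g x ∂μ) x ^ 2 ∂μ ≤
      A ^ 2 * ∫⁻ x in ⋃ i ∈ s, E i, g x ^ 2 ∂μ := by
  set U := ⋃ i ∈ s, E i with hU
  have hUm : MeasurableSet U := Finset.measurableSet_biUnion s hE.meas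
  have e1 : spread μ s P (fun i => ∫⁻ x in E i, g x ∂μ) =
      spread μ s P (fun i => ∫⁻ x in E i, U.indicator g x ∂μ) := by
    funext x
    refine Finset.sum_congr rfl fun i hi => ?_
    have h1 : ∫⁻ x in E i, g x ∂μ = ∫⁻ x in E i, U.indicator g x ∂μ := by
      refine setLIntegral_congr_fun (hE.meas i hi) fun y hy => ?_
      have hyU : y ∈ U := Set.mem_biUnion (Finset.mem_coe.2 hi) hy
      rw [Set.indicator_of_mem hyU]
    simp only [h1]
  have e2 : ∫⁻ x in U, g x ^ 2 ∂μ = l2norm μ (U.indicator g) ^ 2 := by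
    rw [l2norm_sq, ← lintegral_indicator hUm]
    refine lintegral_congr fun x => ?_
    by_cases hx : x ∈ U <;> simp [hx]
  rw [← l2norm_sq, e1, e2, ← mul_pow]
  exact pow_le_pow_left' (h E hE _ (hg.indicator hUm)) 2

variable {ι : Type*} {s : Finset ι} {m a c l h : ι → ℝ}

/-- The interaction between the slopes on the two sides of `m₀` is governed by a family with the
single slope `m₀`. -/
lemma lintegral_spread_mul_spread_le {m₀ : ℝ} {t u : Finset ι} (ht : t ⊆ s) (hu : u ⊆ s)
    (hl : ∀ i ∈ s, 0 < l i) (hh : ∀ i ∈ s, 0 < h i) (htm : ∀ i ∈ t, m i ≤ m₀)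
    (hum : ∀ i ∈ u, m₀ < m i) (w : ι → ℝ≥0∞) :
    ∫⁻ x, spread volume t (fun i => par (m i) (a i) (c i) (l i) (h i)) w x *
        spread volume u (fun i => par (m i) (a i) (c i) (l i) (h i)) w x ≤
      96 * ∫⁻ x, spread volume s (fun i => tiltPar m₀ (m i) (a i) (c i) (l i) (h i)) w x *
        (spread volume t (fun i => par (m i) (a i) (c i) (l i) (h i)) w x +
          spread volume u (fun i => par (m i) (a i) (c i) (l i) (h i)) w x) := by
  set P : ι → Set (ℝ × ℝ) := fun i => par (m i) (a i) (c i) (l i) (h i) with hPdef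
  set Q : ι → Set (ℝ × ℝ) := fun i => tiltPar m₀ (m i) (a i) (c i) (l i) (h i) with hQdef
  have hP : IsAvgFamily volume s P := isAvgFamily_par hl hh
  have hQ : IsAvgFamily volume s Q := isAvgFamily_par
    (fun i hi => by have := hl i hi; positivity)
    (fun i hi => by have := hl i hi; have := hh i hi; positivity)
  have hpair : ∀ i ∈ t, ∀ j ∈ u, volume (P i ∩ P j) / (volume (P i) * volume (P j)) ≤
      96 * (volume (Q i ∩ P j) / (volume (Q i) * volume (P j))) +
        96 * (volume (Q j ∩ P i) / (volume (Q j) * volume (P i))) := by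
    intro i hi j hj
    have hmi := htm i hi
    have hmj := hum j hj
    rcases le_total (l i) (l j) with hij | hij
    · refine (rel_overlap_le (m₀ := m₀) (hl i (ht hi)) (hh i (ht hi)) (hh j (hu hj)) hij
        ?_).trans le_self_add
      rw [abs_of_nonpos (by linarith), abs_of_nonpos (by linarith), abs_of_nonpos (by linarith)]
      ring
    · rw [Set.inter_comm, mul_comm (volume (P i))]
      refine (rel_overlap_le (m₀ := m₀) (hl j (hu hj)) (hh j (hu hj)) (hh i (ht hi)) hij
        ?_).trans le_add_self
      rw [abs_of_nonneg (by linarith), abs_of_nonneg (by linarith), abs_of_nonneg (by linarith)]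
      ring
  have hle : ∀ v ⊆ s, ∀ x, spread volume v Q w x ≤ spread volume s Q w x := fun v hv x =>
    Finset.sum_le_sum_of_subset hv
  calc ∫⁻ x, spread volume t P w x * spread volume u P w x
      = ∑ i ∈ t, ∑ j ∈ u, w i * w j * (volume (P i ∩ P j) / (volume (P i) * volume (P j))) :=
        lintegral_spread_mul_spread (hP.mono ht) (hP.mono hu) w w
    _ ≤ ∑ i ∈ t, ∑ j ∈ u,
          (96 * (w i * w j * (volume (Q i ∩ P j) / (volume (Q i) * volume (P j)))) +
          96 * (w j * w i * (volume (Q j ∩ P i) / (volume (Q j) * volume (P i))))) := by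
        refine Finset.sum_le_sum fun i hi => Finset.sum_le_sum fun j hj => ?_
        refine (mul_le_mul_right (hpair i hi j hj) _).trans_eq ?_
        ring
    _ = 96 * ∑ i ∈ t, ∑ j ∈ u, w i * w j * (volume (Q i ∩ P j) / (volume (Q i) * volume (P j))) +
          96 * ∑ j ∈ u, ∑ i ∈ t,
            w j * w i * (volume (Q j ∩ P i) / (volume (Q j) * volume (P i))) := by
        simp only [Finset.sum_add_distrib, Finset.mul_sum]
        congr 1
        exact Finset.sum_comm
    _ = 96 * (∫⁻ x, spread volume t Q w x * spread volume u P w x) +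
          96 * ∫⁻ x, spread volume u Q w x * spread volume t P w x := by
        rw [lintegral_spread_mul_spread (hQ.mono ht) (hP.mono hu),
          lintegral_spread_mul_spread (hQ.mono hu) (hP.mono ht)]
    _ ≤ 96 * (∫⁻ x, spread volume s Q w x * spread volume u P w x) +
          96 * ∫⁻ x, spread volume s Q w x * spread volume t P w x := by
        gcongr with x x
        · exact hle t ht x
        · exact hle u hu x
    _ = 96 * ∫⁻ x, spread volume s Q w x * (spread volume t P w x + spread volume u P w x) := by
        have h1 : Measurable fun x => spread volume s Q w x * spread volume t P w x :=
          (measurable_spread hQ w).mul (measurable_spread (hP.mono ht) w)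
        simp only [mul_add]
        rw [lintegral_add_left h1, mul_add, add_comm]

/-- Halving the number of slopes changes the norm only by an additive constant. -/
lemma adjointBound_par (k : ℕ) (hl : ∀ i ∈ s, 0 < l i) (hh : ∀ i ∈ s, 0 < h i)
    (hk : (s.image m).card ≤ 2 ^ k) :
    AdjointBound volume s (fun i => par (m i) (a i) (c i) (l i) (h i)) (36 + k * 6912) := by
  classical
  induction k generalizing s with
  | zero =>
    rcases s.eq_empty_or_nonempty with rfl | ⟨i₀, hi₀⟩
    · intro E _ g _
      simp [l2norm, spread]
    · have he : ∀ i ∈ s, m i = m i₀ := fun i hi =>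
        Finset.card_le_one.1 (by simpa using hk) _ (Finset.mem_image_of_mem m hi) _
          (Finset.mem_image_of_mem m hi₀)
      have h0 := adjointBound_par_of_slope (a := a) (c := c) (m i₀) hl hh
      intro E hE g hg
      have e : ∀ w, spread volume s (fun i => par (m i) (a i) (c i) (l i) (h i)) w =
          spread volume s (fun i => par (m i₀) (a i) (c i) (l i) (h i)) w := by
        intro w
        funext x
        exact Finset.sum_congr rfl fun i hi => by simp only [he i hi]
      rw [e]
      simpa using h0 E (hE.enlarge fun i hi => by rw [he i hi]) g hg
  | succ k ih =>
    obtain ⟨m₀, hm1, hm2⟩ := (s.image m).exists_cut (n := 2 ^ k) Nat.one_le_two_pow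
      (by rw [pow_succ'] at hk; exact hk)
    set t := s.filter fun i => m i ≤ m₀ with ht
    set u := s.filter fun i => m₀ < m i with hu
    have hts : t ⊆ s := Finset.filter_subset _ s
    have hus : u ⊆ s := Finset.filter_subset _ s
    have htu : Disjoint t u := by
      rw [Finset.disjoint_filter]
      intro i _ h1
      exact h1.not_gt
    have htus : t ∪ u = s := by
      ext i
      simp only [ht, hu, Finset.mem_union, Finset.mem_filter]
      have := le_or_gt (m i) m₀
      tauto
    have bt := ih (s := t) (fun i hi => hl i (hts hi)) (fun i hi => hh i (hts hi))
      (by rw [Finset.filter_image] at hm1; exact hm1)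
    have bu := ih (s := u) (fun i hi => hl i (hus hi)) (fun i hi => hh i (hus hi))
      (by rw [Finset.filter_image] at hm2; exact hm2)
    intro E hE g hg
    rcases eq_or_ne (l2norm volume g) ∞ with hg2 | hg2
    · rw [hg2, ENNReal.mul_top (by simp)]
      exact le_top
    set P : ι → Set (ℝ × ℝ) := fun i => par (m i) (a i) (c i) (l i) (h i) with hPdef
    set Q : ι → Set (ℝ × ℝ) := fun i => tiltPar m₀ (m i) (a i) (c i) (l i) (h i) with hQdef
    have hP : IsAvgFamily volume s P := isAvgFamily_par hl hh
    have hl' : ∀ i ∈ s, 0 < 3 * l i := fun i hi => by have := hl i hi; positivity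
    have hh' : ∀ i ∈ s, 0 < 4 * (h i + |m i - m₀| * l i) := fun i hi => by
      have := hl i hi; have := hh i hi; positivity
    have hQ : IsAvgFamily volume s Q := isAvgFamily_par hl' hh'
    have bQ : AdjointBound volume s Q 36 := adjointBound_par_of_slope m₀ hl' hh'
    have hEQ : IsSelection s Q E :=
      hE.enlarge fun i hi => par_subset_tiltPar (hl i hi) (hh i hi)
    set w : ι → ℝ≥0∞ := fun i => ∫⁻ x in E i, g x with hw
    set S := spread volume s P w with hS
    have hSm : Measurable S := measurable_spread hP w
    have hS2 : l2norm volume S ≠ ∞ := l2norm_spread_ne_top hP (hE.setLIntegral_ne_top hP hg hg2)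
    have hsplit : ∀ x, S x = spread volume t P w x + spread volume u P w x := by
      intro x
      simp only [hS, spread]
      rw [← Finset.sum_union htu, htus]
    have htm := measurable_spread (hP.mono hts) w
    have hum := measurable_spread (hP.mono hus) w
    have hdiag : (∫⁻ x, spread volume t P w x ^ 2) + ∫⁻ x, spread volume u P w x ^ 2 ≤
        ((36 + k * 6912) * l2norm volume g) ^ 2 := by
      refine (add_le_add (bt.lintegral_sq_le (hE.mono hts) hg)
        (bu.lintegral_sq_le (hE.mono hus) hg)).trans ?_
      have hd : Disjoint (⋃ i ∈ t, E i) (⋃ i ∈ u, E i) := by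
        simp only [Set.disjoint_iUnion_left, Set.disjoint_iUnion_right]
        intro i hi j hj
        exact hE.disj (hts hj) (hus hi) (fun hij => Finset.disjoint_left.1 htu hj (hij ▸ hi))
      rw [← mul_add, ← lintegral_union
        (Finset.measurableSet_biUnion u fun i hi => hE.meas i (hus hi)) hd, mul_pow, l2norm_sq]
      gcongr
      exact Measure.restrict_le_self
    have hcross : ∫⁻ x, spread volume t P w x * spread volume u P w x ≤
        96 * (36 * l2norm volume g * l2norm volume S) := by
      refine (lintegral_spread_mul_spread_le (m₀ := m₀) hts hus hl hh
        (fun i hi => (Finset.mem_filter.1 hi).2) (fun i hi => (Finset.mem_filter.1 hi).2)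
        w).trans ?_
      simp_rw [← hPdef, ← hsplit]
      gcongr
      refine (lintegral_mul_le_l2norm _ (measurable_spread hQ w).aemeasurable
        hSm.aemeasurable).trans ?_
      gcongr
      exact bQ E hEQ g hg
    have hsq : l2norm volume S ^ 2 ≤ ((36 + k * 6912) * l2norm volume g) ^ 2 +
        6912 * l2norm volume g * l2norm volume S := by
      rw [l2norm_sq]
      have e : ∀ x, S x ^ 2 = spread volume t P w x ^ 2 + spread volume u P w x ^ 2 +
          2 * (spread volume t P w x * spread volume u P w x) := fun x => by rw [hsplit]; ring
      simp_rw [e]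
      have hadd : Measurable fun x => spread volume t P w x ^ 2 + spread volume u P w x ^ 2 :=
        (htm.pow_const 2).add (hum.pow_const 2)
      have hmul : Measurable fun x => spread volume t P w x * spread volume u P w x := htm.mul hum
      rw [lintegral_add_left hadd, lintegral_add_left (htm.pow_const 2), lintegral_const_mul _ hmul]
      refine (add_le_add hdiag (mul_le_mul_right hcross 2)).trans_eq ?_
      ring
    refine (ENNReal.le_add_of_sq_le hS2 hsq).trans_eq ?_
    push_cast
    ring

end Slopes

/-! ### From rectangles to parallelograms with rational parameters -/

section Rectangles

/-- In coordinates: the rectangle with center `(p, q)`, half-side `a` along `(u, v)` and half-side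
`b` along `(-v, u)`. -/
def tiltBox (p q u v a b : ℝ) : Set (ℝ × ℝ) :=
  {z | |(z.1 - p) * u + (z.2 - q) * v| ≤ a ∧ |-(z.1 - p) * v + (z.2 - q) * u| ≤ b}

lemma two_thirds_le_abs {u v : ℝ} (huv : u ^ 2 + v ^ 2 = 1) (hvu : |v| ≤ |u|) : 2 / 3 ≤ |u| := by
  have hsq : v ^ 2 ≤ u ^ 2 := sq_le_sq.2 hvu
  refine abs_le_of_sq_le_sq' ?_ (abs_nonneg u) |>.2
  rw [sq_abs]
  linarith

lemma par_subset_tiltBox {p q u v a b : ℝ} (huv : u ^ 2 + v ^ 2 = 1) (hvu : |v| ≤ |u|)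
    (hb : 0 < b) (hba : b ≤ a) : par (v / u) p q (a / 8) b ⊆ tiltBox p q u v a b := by
  have hsq : v ^ 2 ≤ u ^ 2 := sq_le_sq.2 hvu
  have hu := two_thirds_le_abs huv hvu
  have hu0 : u ≠ 0 := fun h => by norm_num [h] at hu
  have hu1 : |u| ≤ 1 := abs_le_one_iff_mul_self_le_one.2 (by nlinarith [sq_nonneg v])
  have hv1 : |v| ≤ 3 / 4 := by
    refine abs_le_of_sq_le_sq' ?_ (by norm_num) |>.2
    rw [sq_abs]
    linarith
  rintro z ⟨h1, h2⟩
  set X := z.1 - p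
  set t := z.2 - (v / u * X + q) with ht
  have e : z.2 - q = t + v / u * X := by rw [ht]; ring
  refine ⟨?_, ?_⟩
  · have e1 : X * u + (z.2 - q) * v = X / u + t * v := by
      rw [e]
      field_simp
      linear_combination X * huv
    rw [e1]
    have h3 : |X / u| ≤ 3 / 16 * a := by
      rw [abs_div, div_le_iff₀ (by linarith)]
      nlinarith
    have h4 : |t * v| ≤ b * (3 / 4) := by
      rw [abs_mul]
      gcongr
    linarith [abs_add_le (X / u) (t * v)]
  · have e2 : -X * v + (z.2 - q) * u = t * u := by
      rw [e]
      field_simp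
      ring
    rw [e2, abs_mul]
    calc |t| * |u| ≤ b * 1 := by gcongr
      _ = b := mul_one b

lemma tiltBox_subset {p q u v a b : ℝ} (huv : u ^ 2 + v ^ 2 = 1) (hvu : |v| ≤ |u|)
    (hb : 0 < b) (hba : b ≤ a) {z : ℝ × ℝ} (hz : z ∈ tiltBox p q u v a b) :
    |z.1 - p| ≤ 2 * a ∧ |z.2 - q - v / u * (z.1 - p)| ≤ 3 / 2 * b := by
  have hu := two_thirds_le_abs huv hvu
  have hu0 : u ≠ 0 := fun h => by norm_num [h] at hu
  have hu1 : |u| ≤ 1 := abs_le_one_iff_mul_self_le_one.2 (by nlinarith [sq_nonneg v])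
  obtain ⟨h1, h2⟩ := hz
  set X := z.1 - p
  set Y := z.2 - q
  constructor
  · have e : X = u * (X * u + Y * v) - v * (-X * v + Y * u) := by linear_combination -X * huv
    rw [e]
    refine (abs_sub _ _).trans ?_
    rw [abs_mul, abs_mul]
    calc |u| * |X * u + Y * v| + |v| * |-X * v + Y * u| ≤ 1 * a + 1 * b := by
          gcongr
          exact hvu.trans hu1
      _ ≤ 2 * a := by linarith
  · have e : Y - v / u * X = (-X * v + Y * u) / u := by field_simp; ring
    rw [e, abs_div, div_le_iff₀ (by linarith)]
    nlinarith

/-- A rectangle whose long side makes an angle of at most `π / 4` with the horizontal axis lies in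
a parallelogram of comparable area with two vertical sides, of the same slope and with otherwise
rational parameters. -/
lemma exists_rat_par {p q u v a b : ℝ} (huv : u ^ 2 + v ^ 2 = 1) (hvu : |v| ≤ |u|)
    (hb : 0 < b) (hba : b ≤ a) :
    ∃ (x y : ℚ) (l h : {r : ℚ // 0 < r}), tiltBox p q u v a b ⊆ par (v / u) x y l h ∧
      volume (par (v / u) x y l h) ≤ 96 * volume (tiltBox p q u v a b) := by
  have ha : 0 < a := hb.trans_le hba
  obtain ⟨x, hx1, hx2⟩ := exists_rat_btwn (show p - a < p + a by linarith)
  obtain ⟨y, hy1, hy2⟩ := exists_rat_btwn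
    (show q + v / u * (x - p) - b < q + v / u * (x - p) + b by linarith)
  obtain ⟨l, hl1, hl2⟩ := exists_rat_btwn (show 3 * a < 4 * a by linarith)
  obtain ⟨h, hh1, hh2⟩ := exists_rat_btwn (show 5 / 2 * b < 3 * b by linarith)
  have hl0 : 0 < l := by exact_mod_cast (by linarith : (0 : ℝ) < l)
  have hh0 : 0 < h := by exact_mod_cast (by linarith : (0 : ℝ) < h)
  refine ⟨x, y, ⟨l, hl0⟩, ⟨h, hh0⟩, fun z hz => ?_, ?_⟩
  · obtain ⟨h1, h2⟩ := tiltBox_subset huv hvu hb hba hz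
    have e : z.2 - (v / u * (z.1 - x) + y) =
        (z.2 - q - v / u * (z.1 - p)) + (q + v / u * (x - p) - y) := by ring
    refine ⟨?_, ?_⟩
    · rw [abs_le] at *
      constructor <;> linarith
    · rw [e]
      rw [abs_le] at *
      constructor <;> linarith
  · calc volume (par (v / u) x y l h) = ENNReal.ofReal (4 * l * h) :=
          volume_par _ _ _ _ _ (by linarith)
      _ ≤ ENNReal.ofReal (96 * (4 * (a / 8) * b)) := by
        refine ENNReal.ofReal_le_ofReal ?_
        calc (4 * l * h : ℝ) ≤ 4 * (4 * a) * (3 * b) := by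
              have : (0 : ℝ) < h := by linarith
              gcongr
          _ = _ := by ring
      _ = 96 * volume (par (v / u) p q (a / 8) b) := by
        rw [volume_par _ _ _ _ _ (by positivity), ENNReal.ofReal_mul (by norm_num)]
        norm_num
      _ ≤ _ := by
        gcongr
        exact par_subset_tiltBox huv hvu hb hba

/-- The coordinates of the plane. -/
def planeCoord : Plane ≃ᵐ ℝ × ℝ :=
  (MeasurableEquiv.toLp 2 (Fin 2 → ℝ)).symm.trans MeasurableEquiv.finTwoArrow

/-- The coordinates of the plane in reverse order. -/
def planeCoordSwap : Plane ≃ᵐ ℝ × ℝ :=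
  planeCoord.trans MeasurableEquiv.prodComm

lemma planeCoord_apply (y : Plane) : planeCoord y = (y 0, y 1) := rfl

lemma planeCoordSwap_apply (y : Plane) : planeCoordSwap y = (y 1, y 0) := rfl

lemma measurePreserving_planeCoord : MeasurePreserving planeCoord volume volume :=
  (volume_preserving_finTwoArrow ℝ).comp
    (EuclideanSpace.volume_preserving_symm_measurableEquiv_toLp (Fin 2))

lemma measurePreserving_planeCoordSwap : MeasurePreserving planeCoordSwap volume volume :=
  (Measure.measurePreserving_swap (μ := (volume : Measure ℝ)) (ν := (volume : Measure ℝ))).comp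
    measurePreserving_planeCoord

lemma inner_plane (x y : Plane) : inner ℝ x y = x 0 * y 0 + x 1 * y 1 := by
  simp [PiLp.inner_apply, Fin.sum_univ_two, mul_comm]

lemma norm_plane {v : Plane} (hv : ‖v‖ = 1) : v 0 ^ 2 + v 1 ^ 2 = 1 := by
  have := EuclideanSpace.real_norm_sq_eq v
  rw [hv, Fin.sum_univ_two] at this
  linarith

lemma rect_eq_planeCoord (c v : Plane) (a b : ℝ) :
    rect c v a b = planeCoord ⁻¹' tiltBox (c 0) (c 1) (v 0) (v 1) a b := by
  ext y
  simp only [rect, tiltBox, Set.mem_preimage, Set.mem_ofPred_eq, inner_plane, planeCoord_apply,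
    perpVec]
  simp [-neg_sub]

lemma rect_eq_planeCoordSwap (c v : Plane) (a b : ℝ) :
    rect c v a b = planeCoordSwap ⁻¹' tiltBox (c 1) (c 0) (v 1) (v 0) a b := by
  ext y
  simp only [rect, tiltBox, Set.mem_preimage, Set.mem_ofPred_eq, inner_plane, planeCoordSwap_apply,
    perpVec]
  rw [← abs_neg (-(y 1 - c 1) * v 0 + _), add_comm ((y 1 - c 1) * v 1)]
  simp [-neg_sub, add_comm]

lemma rect_perpVec (c v : Plane) (a b : ℝ) : rect c v a b = rect c (perpVec v) b a := by
  ext y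
  have : inner ℝ (y - c) (perpVec (perpVec v)) = -inner ℝ (y - c) v := by
    simp [inner_plane, perpVec]
    ring
  simp only [rect, Set.mem_ofPred_eq, this, abs_neg]
  exact and_comm

lemma norm_perpVec {v : Plane} (hv : v 0 ^ 2 + v 1 ^ 2 = 1) :
    perpVec v 0 ^ 2 + perpVec v 1 ^ 2 = 1 := by
  simp [perpVec]
  linarith

end Rectangles

/-! ### Maximal functions with finitely many slopes -/

section SlopeMaximal

/-- Parameters of the parallelograms with slopes in `S` and otherwise rational data. -/
abbrev SlopeIndex (S : Finset ℝ) : Type :=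
  {m // m ∈ S} × ℚ × ℚ × {r : ℚ // 0 < r} × {r : ℚ // 0 < r}

/-- The parallelogram with the given parameters. -/
def slopePar {S : Finset ℝ} (i : SlopeIndex S) : Set (ℝ × ℝ) :=
  par i.1 i.2.1 i.2.2.1 i.2.2.2.1 i.2.2.2.2

/-- The maximal function over parallelograms with slopes in `S`. -/
noncomputable def slopeMax (S : Finset ℝ) (f : ℝ × ℝ → ℝ≥0∞) (z : ℝ × ℝ) : ℝ≥0∞ :=
  ⨆ i : SlopeIndex S, (slopePar i).indicator
    (fun _ => (∫⁻ y in slopePar i, f y) / volume (slopePar i)) z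

lemma isAvgFamily_slopePar {S : Finset ℝ} (s : Finset (SlopeIndex S)) :
    IsAvgFamily volume s slopePar :=
  isAvgFamily_par (fun i _ => by exact_mod_cast i.2.2.2.1.2)
    (fun i _ => by exact_mod_cast i.2.2.2.2.2)

lemma measurable_slopeMax (S : Finset ℝ) (f : ℝ × ℝ → ℝ≥0∞) : Measurable (slopeMax S f) :=
  Measurable.iSup fun i =>
    measurable_const.indicator ((isAvgFamily_slopePar {i}).meas i (by simp))

lemma l2norm_slopeMax_le {S : Finset ℝ} {k : ℕ} (hS : S.card ≤ 2 ^ k) {f : ℝ × ℝ → ℝ≥0∞}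
    (hf : Measurable f) :
    l2norm volume (slopeMax S f) ≤ (36 + k * 6912) * l2norm volume f := by
  refine l2norm_iSup_le (fun i =>
    measurable_const.indicator ((isAvgFamily_slopePar {i}).meas i (by simp))) fun s => ?_
  have hs : (s.image fun i => (i.1 : ℝ)).card ≤ 2 ^ k := by
    refine (Finset.card_le_card fun m hm => ?_).trans hS
    obtain ⟨i, -, rfl⟩ := Finset.mem_image.1 hm
    exact i.1.2
  have h := adjointBound_par (a := fun i : SlopeIndex S => (i.2.1 : ℝ))
    (c := fun i => (i.2.2.1 : ℝ)) (l := fun i => (i.2.2.2.1 : ℝ)) (h := fun i => (i.2.2.2.2 : ℝ))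
    (s := s) k (fun i _ => by exact_mod_cast i.2.2.2.1.2) (fun i _ => by exact_mod_cast i.2.2.2.2.2)
    hs
  exact h.maxBound (isAvgFamily_slopePar s) (by simp) f hf

/-- A set contained in a parallelogram of comparable measure has averages bounded by the maximal
function. -/
lemma avg_le_slopeMax {S : Finset ℝ} (e : Plane ≃ᵐ ℝ × ℝ) (he : MeasurePreserving e volume volume)
    {T : Set (ℝ × ℝ)} {i : SlopeIndex S} (hT : T ⊆ slopePar i)
    (hvol : volume (slopePar i) ≤ 96 * volume T) (f : Plane → ℝ≥0∞) {x : Plane} (hx : e x ∈ T) :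
    (volume (e ⁻¹' T))⁻¹ * ∫⁻ y in e ⁻¹' T, f y ≤
      96 * slopeMax S (fun z => f (e.symm z)) (e x) := by
  have h1 : (volume T)⁻¹ ≤ 96 * (volume (slopePar i))⁻¹ := by
    have h := ENNReal.inv_le_inv.2 hvol
    rw [ENNReal.mul_inv (.inl (by norm_num)) (.inl (by norm_num))] at h
    calc (volume T)⁻¹ = 96 * (96⁻¹ * (volume T)⁻¹) := by
          rw [← mul_assoc, ENNReal.mul_inv_cancel (by norm_num) (by norm_num), one_mul]
      _ ≤ _ := by gcongr
  have h2 : ∫⁻ y in e ⁻¹' T, f y ≤ ∫⁻ z in slopePar i, f (e.symm z) := by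
    rw [← he.setLIntegral_comp_preimage_emb e.measurableEmbedding]
    simp only [MeasurableEquiv.symm_apply_apply]
    exact lintegral_mono_set (Set.preimage_mono hT)
  calc (volume (e ⁻¹' T))⁻¹ * ∫⁻ y in e ⁻¹' T, f y
      ≤ 96 * (volume (slopePar i))⁻¹ * ∫⁻ z in slopePar i, f (e.symm z) := by
        rw [he.measure_preimage_equiv]
        gcongr
    _ = 96 * (slopePar i).indicator (fun _ => (∫⁻ y in slopePar i, f (e.symm y)) /
          volume (slopePar i)) (e x) := by
        rw [Set.indicator_of_mem (hT hx), div_eq_mul_inv]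
        ring
    _ ≤ _ := by
        gcongr
        exact le_iSup (fun i : SlopeIndex S => (slopePar i).indicator
          (fun _ => (∫⁻ y in slopePar i, f (e.symm y)) / volume (slopePar i)) (e x)) i

/-- The directions of all sides of the rectangles with a side in a direction from `Ω`. -/
noncomputable def sideDirs (Ω : Finset Plane) : Finset Plane := by
  classical exact Ω ∪ Ω.image perpVec

lemma card_sideDirs_le (Ω : Finset Plane) : (sideDirs Ω).card ≤ 2 * Ω.card := by
  classical
  unfold sideDirs
  refine (Finset.card_union_le _ _).trans ?_
  have := Finset.card_image_le (s := Ω) (f := perpVec)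
  omega

/-- The slopes of these sides with respect to the first coordinate axis. Only the slopes of absolute
value at most `1` matter, so the value `0` for a vertical side does no harm. -/
noncomputable def slopes (Ω : Finset Plane) : Finset ℝ :=
  (sideDirs Ω).image fun u => u 1 / u 0

/-- The slopes of these sides with respect to the second coordinate axis, with the same convention
for horizontal sides. -/
noncomputable def slopesSwap (Ω : Finset Plane) : Finset ℝ :=
  (sideDirs Ω).image fun u => u 0 / u 1

lemma avg_rect_le {Ω : Finset Plane} {u : Plane} (hu : u ∈ sideDirs Ω)
    (hu1 : u 0 ^ 2 + u 1 ^ 2 = 1) {c : Plane} {a b : ℝ} (hb : 0 < b) (hba : b ≤ a)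
    (f : Plane → ℝ≥0∞) {x : Plane} (hx : x ∈ rect c u a b) :
    (volume (rect c u a b))⁻¹ * ∫⁻ y in rect c u a b, f y ≤
      96 * slopeMax (slopes Ω) (fun z => f (planeCoord.symm z)) (planeCoord x) +
      96 * slopeMax (slopesSwap Ω) (fun z => f (planeCoordSwap.symm z)) (planeCoordSwap x) := by
  rcases le_total |u 1| |u 0| with h | h
  · refine le_trans ?_ le_self_add
    obtain ⟨p, q, l, k, h1, h2⟩ := exists_rat_par (p := c 0) (q := c 1) hu1 h hb hba
    rw [rect_eq_planeCoord] at hx ⊢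
    exact avg_le_slopeMax (S := slopes Ω) (i := (⟨_, Finset.mem_image_of_mem _ hu⟩, p, q, l, k))
      planeCoord measurePreserving_planeCoord h1 h2 f hx
  · refine le_trans ?_ le_add_self
    obtain ⟨p, q, l, k, h1, h2⟩ := exists_rat_par (p := c 1) (q := c 0)
      ((add_comm _ _).trans hu1) h hb hba
    rw [rect_eq_planeCoordSwap] at hx ⊢
    exact avg_le_slopeMax (S := slopesSwap Ω) (i := (⟨_, Finset.mem_image_of_mem _ hu⟩, p, q, l, k))
      planeCoordSwap measurePreserving_planeCoordSwap h1 h2 f hx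

lemma dirMaximal_le {Ω : Finset Plane} (hΩ : ∀ v ∈ Ω, ‖v‖ = 1) (f : Plane → ℂ) (x : Plane) :
    dirMaximal (Ω : Set Plane) f x ≤
      96 * slopeMax (slopes Ω) (fun z => ‖f (planeCoord.symm z)‖ₑ) (planeCoord x) +
      96 * slopeMax (slopesSwap Ω) (fun z => ‖f (planeCoordSwap.symm z)‖ₑ) (planeCoordSwap x) := by
  classical
  refine iSup₂_le fun R hR => iSup_le fun hx => ?_
  obtain ⟨v, hv, c, a, b, ha, hb, rfl⟩ := hR
  have hv1 := norm_plane (hΩ v hv)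
  rcases le_total b a with hba | hab
  · exact avg_rect_le (Finset.mem_union_left _ hv) hv1 hb hba (fun y => ‖f y‖ₑ) hx
  · rw [rect_perpVec] at hx ⊢
    exact avg_rect_le (Finset.mem_union_right _ (Finset.mem_image_of_mem _ hv)) (norm_perpVec hv1)
      ha hab (fun y => ‖f y‖ₑ) hx

lemma l2norm_dirMaximal_le {Ω : Finset Plane} (hΩ : ∀ v ∈ Ω, ‖v‖ = 1) {k : ℕ}
    (hk : 2 * Ω.card ≤ 2 ^ k) {f : Plane → ℂ} (hf : Measurable f) :
    l2norm volume (dirMaximal (Ω : Set Plane) f) ≤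
      192 * (36 + k * 6912) * l2norm volume fun x => ‖f x‖ₑ := by
  have key : ∀ (S : Finset ℝ) (e : Plane ≃ᵐ ℝ × ℝ), MeasurePreserving e volume volume →
      S.card ≤ 2 ^ k → l2norm volume (fun x => 96 * slopeMax S (fun z => ‖f (e.symm z)‖ₑ) (e x)) ≤
        96 * ((36 + k * 6912) * l2norm volume fun x => ‖f x‖ₑ) := by
    intro S e he hS
    have hm : Measurable fun z => ‖f (e.symm z)‖ₑ := (hf.comp e.symm.measurable).enorm
    have h1 := l2norm_comp he (measurable_slopeMax S fun z => ‖f (e.symm z)‖ₑ)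
    have h2 := l2norm_comp he hm
    simp only [MeasurableEquiv.symm_apply_apply] at h2
    have h3 : Measurable fun x => slopeMax S (fun z => ‖f (e.symm z)‖ₑ) (e x) :=
      (measurable_slopeMax S _).comp e.measurable
    rw [l2norm_const_mul _ _ h3, h1, h2]
    gcongr
    exact l2norm_slopeMax_le hS hm
  have hc := (card_sideDirs_le Ω).trans hk
  refine (l2norm_mono (dirMaximal_le hΩ f)).trans ?_
  refine (l2norm_add_le _ (((measurable_slopeMax _ _).comp planeCoord.measurable).const_mul _)
    (((measurable_slopeMax _ _).comp planeCoordSwap.measurable).const_mul _)).trans ?_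
  refine (add_le_add
    (key (slopes Ω) _ measurePreserving_planeCoord (Finset.card_image_le.trans hc))
    (key (slopesSwap Ω) _ measurePreserving_planeCoordSwap
      (Finset.card_image_le.trans hc))).trans_eq ?_
  ring

end SlopeMaximal

/-! ### Measurability, and the bound for arbitrary directions -/

section Katz

lemma rect_homothety (c v : Plane) (a b : ℝ) {r : ℝ} (hr : 0 < r) :
    rect c v (r * a) (r * b) = AffineMap.homothety c r '' rect c v a b := by
  ext y
  constructor
  · intro hy
    refine ⟨AffineMap.homothety c r⁻¹ y, ?_, ?_⟩
    · simp only [rect, Set.mem_ofPred_eq, AffineMap.homothety_apply, vsub_eq_sub, vadd_eq_add,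
        add_sub_cancel_right, inner_smul_left, abs_mul] at hy ⊢
      simp only [conj_trivial, abs_inv, abs_of_pos hr]
      rw [inv_mul_le_iff₀ hr, inv_mul_le_iff₀ hr]
      exact hy
    · simp [AffineMap.homothety_apply, smul_smul, hr.ne']
  · rintro ⟨z, hz, rfl⟩
    simp only [rect, Set.mem_ofPred_eq, AffineMap.homothety_apply, vsub_eq_sub, vadd_eq_add,
      add_sub_cancel_right, inner_smul_left, abs_mul] at hz ⊢
    simp only [conj_trivial, abs_of_pos hr]
    exact ⟨mul_le_mul_of_nonneg_left hz.1 hr.le, mul_le_mul_of_nonneg_left hz.2 hr.le⟩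

/-- A slight enlargement of a rectangle contains a neighborhood of each of its points, so the
maximal function exceeds a given level on an open set. -/
lemma lowerSemicontinuous_dirMaximal (Ω : Set Plane) (f : Plane → ℂ) :
    LowerSemicontinuous (dirMaximal Ω f) := by
  intro x t ht
  simp only [dirMaximal, gt_iff_lt, lt_iSup_iff] at ht
  obtain ⟨R, ⟨v, hv, c, a, b, ha, hb, rfl⟩, hx, ht⟩ := ht
  set A := (volume (rect c v a b))⁻¹ * ∫⁻ y in rect c v a b, ‖f y‖ₑ with hA
  obtain ⟨r, hr1, hr2⟩ : ∃ r : ℝ, 1 < r ∧ t < (ENNReal.ofReal (r ^ 2))⁻¹ * A := by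
    have h1 : Filter.Tendsto (fun r : ℝ => (ENNReal.ofReal (r ^ 2))⁻¹ * A)
        (nhdsWithin 1 (Set.Ioi 1)) (nhds ((ENNReal.ofReal (1 ^ 2))⁻¹ * A)) := by
      refine ENNReal.Tendsto.mul_const ?_ (Or.inl (by simp))
      have : Continuous fun r : ℝ => (ENNReal.ofReal (r ^ 2))⁻¹ :=
        (ENNReal.continuous_ofReal.comp (continuous_pow 2)).inv
      exact this.continuousAt.continuousWithinAt
    have h2 : t < (ENNReal.ofReal (1 ^ 2))⁻¹ * A := by simpa using ht
    obtain ⟨r, hr⟩ := ((h1.eventually (lt_mem_nhds h2)).and self_mem_nhdsWithin).exists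
    exact ⟨r, hr.2, hr.1⟩
  have hr0 : 0 < r := by linarith
  have hopen : IsOpen {y : Plane | |inner ℝ (y - c) v| < r * a ∧
      |inner ℝ (y - c) (perpVec v)| < r * b} :=
    (isOpen_lt (f := fun y : Plane => |inner ℝ (y - c) v|) (by fun_prop) continuous_const).inter
      (isOpen_lt (f := fun y : Plane => |inner ℝ (y - c) (perpVec v)|) (by fun_prop)
        continuous_const)
  filter_upwards [hopen.mem_nhds ⟨hx.1.trans_lt (by nlinarith), hx.2.trans_lt (by nlinarith)⟩]
    with y hy
  refine lt_of_lt_of_le hr2 ?_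
  have hsub : rect c v a b ⊆ rect c v (r * a) (r * b) := fun z hz =>
    ⟨hz.1.trans (by nlinarith), hz.2.trans (by nlinarith)⟩
  calc (ENNReal.ofReal (r ^ 2))⁻¹ * A
      ≤ (volume (rect c v (r * a) (r * b)))⁻¹ * ∫⁻ z in rect c v (r * a) (r * b), ‖f z‖ₑ := by
        rw [rect_homothety c v a b hr0, Measure.addHaar_image_homothety,
          ← rect_homothety c v a b hr0, finrank_euclideanSpace_fin, abs_of_nonneg (by positivity),
          hA, ← mul_assoc,
          ENNReal.mul_inv (.inl (by simpa using by positivity)) (.inl ENNReal.ofReal_ne_top)]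
        gcongr
    _ ≤ dirMaximal Ω f y := by
        refine le_iSup₂_of_le _ ⟨v, hv, c, r * a, r * b, by positivity, by positivity, rfl⟩ ?_
        exact le_iSup (fun _ : y ∈ rect c v (r * a) (r * b) => _) ⟨hy.1.le, hy.2.le⟩

lemma dirMaximal_congr_ae (Ω : Set Plane) {f g : Plane → ℂ} (h : f =ᵐ[volume] g) :
    dirMaximal Ω f = dirMaximal Ω g := by
  funext x
  unfold dirMaximal
  refine iSup_congr fun R => iSup_congr fun _ => iSup_congr fun _ => ?_
  congr 1
  refine lintegral_congr_ae ?_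
  filter_upwards [ae_restrict_of_ae h] with y hy
  rw [hy]

lemma eLpNorm_two_eq_l2norm {α ε : Type*} [MeasurableSpace α] [TopologicalSpace ε]
    [ContinuousENorm ε] (μ : Measure α) (f : α → ε) :
    eLpNorm f 2 μ = l2norm μ fun x => ‖f x‖ₑ := by
  rw [eLpNorm_eq_lintegral_rpow_enorm_toReal (by norm_num) (by norm_num)]
  simp [l2norm]

theorem eLpNorm_dirMaximal_le : ∃ K : ℝ, 0 < K ∧
    ∀ Ω : Finset Plane, (∀ v ∈ Ω, ‖v‖ = 1) → 2 ≤ Ω.card →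
      ∀ f : Plane → ℂ, MemLp f 2 volume →
        Measurable (dirMaximal (Ω : Set Plane) f) ∧
        eLpNorm (dirMaximal (Ω : Set Plane) f) 2 volume ≤
          ENNReal.ofReal (K * Real.log (Ω.card : ℝ)) * eLpNorm f 2 volume := by
  have hlog2 : 0 < Real.log 2 := Real.log_pos (by norm_num)
  refine ⟨192 * 20772 / Real.log 2, by positivity, fun Ω hΩ hn f hf => ?_⟩
  refine ⟨(lowerSemicontinuous_dirMaximal _ f).measurable, ?_⟩
  -- `2 ^ (L + 2)` exceeds the at most `2 n` slopes, and `L ≥ 1` absorbs the additive constants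
  set L := Nat.log 2 Ω.card with hL
  have hL1 : 1 ≤ L := Nat.log_pos (by norm_num) hn
  have hk : 2 * Ω.card ≤ 2 ^ (L + 2) := by
    have := Nat.lt_pow_succ_log_self (b := 2) (by norm_num) Ω.card
    rw [pow_succ]
    rw [← hL] at this
    omega
  have hLlog : L * Real.log 2 ≤ Real.log Ω.card := by
    rw [← Real.log_pow]
    refine Real.log_le_log (by positivity) ?_
    exact_mod_cast Nat.pow_log_le_self 2 (by omega)
  obtain ⟨f', hf', hff'⟩ := hf.1.aemeasurable
  rw [dirMaximal_congr_ae _ hff', eLpNorm_congr_ae hff', eLpNorm_two_eq_l2norm,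
    eLpNorm_two_eq_l2norm]
  simp only [enorm_eq_self]
  refine (l2norm_dirMaximal_le hΩ hk hf').trans ?_
  gcongr
  calc (192 * (36 + (L + 2 : ℕ) * 6912) : ℝ≥0∞) = ENNReal.ofReal (192 * (36 + (L + 2) * 6912)) := by
        rw [show (192 * (36 + (L + 2) * 6912) : ℝ) = ((192 * (36 + (L + 2) * 6912) : ℕ) : ℝ) by
          push_cast; ring, ENNReal.ofReal_natCast]
        push_cast
        ring
    _ ≤ _ := by
        refine ENNReal.ofReal_le_ofReal ?_
        rw [div_mul_eq_mul_div, le_div_iff₀ hlog2]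
        have : (1 : ℝ) ≤ L := by exact_mod_cast hL1
        nlinarith

end Katz

/-! ### Directions and angles -/

section Angles

lemma dirOfAngle_eq_iff {s t : ℝ} :
    dirOfAngle s = dirOfAngle t ↔ ∃ k : ℤ, s = t + 2 * Real.pi * k := by
  have h : dirOfAngle s = dirOfAngle t ↔ Real.cos s = Real.cos t ∧ Real.sin s = Real.sin t := by
    constructor
    · intro h
      exact ⟨by simpa [dirOfAngle] using congrArg (fun v : Plane => v 0) h,
        by simpa [dirOfAngle] using congrArg (fun v : Plane => v 1) h⟩
    · rintro ⟨h1, h2⟩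
      simp [dirOfAngle, h1, h2]
  rw [h]
  constructor
  · rintro ⟨h1, h2⟩
    obtain ⟨k, hk⟩ := Real.Angle.angle_eq_iff_two_pi_dvd_sub.1 (Real.Angle.cos_sin_inj h1 h2)
    exact ⟨k, by linarith⟩
  · rintro ⟨k, rfl⟩
    rw [mul_comm]
    exact ⟨Real.cos_add_int_mul_two_pi t k, Real.sin_add_int_mul_two_pi t k⟩

lemma dirOfAngle_add_two_pi (t : ℝ) : dirOfAngle (t + 2 * Real.pi) = dirOfAngle t :=
  dirOfAngle_eq_iff.2 ⟨1, by simp⟩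

lemma dirOfAngle_add_int_mul (t : ℝ) (k : ℤ) : dirOfAngle (t + 2 * Real.pi * k) = dirOfAngle t :=
  dirOfAngle_eq_iff.2 ⟨k, rfl⟩

lemma norm_dirOfAngle (t : ℝ) : ‖dirOfAngle t‖ = 1 := by
  simp [dirOfAngle, EuclideanSpace.norm_eq, Fin.sum_univ_two]

lemma continuous_dirOfAngle : Continuous dirOfAngle := by
  unfold dirOfAngle
  refine (PiLp.continuous_toLp 2 _).comp (continuous_pi fun i => ?_)
  fin_cases i
  · exact Real.continuous_cos
  · exact Real.continuous_sin

lemma dirOfAngle_injOn : Set.InjOn dirOfAngle (Set.Ico 0 (2 * Real.pi)) := by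
  intro s hs t ht h
  obtain ⟨k, hk⟩ := dirOfAngle_eq_iff.1 h
  have hpi := Real.pi_pos
  have h1 : (k : ℝ) < 1 := by nlinarith [hs.2, ht.1]
  have h2 : (-1 : ℝ) < k := by nlinarith [hs.1, ht.2]
  have h3 : k < 1 := by exact_mod_cast h1
  have h4 : -1 < k := by exact_mod_cast h2
  obtain rfl : k = 0 := by omega
  simpa using hk

lemma exists_dirOfAngle {v : Plane} (hv : ‖v‖ = 1) :
    ∃ t ∈ Set.Ico 0 (2 * Real.pi), dirOfAngle t = v := by
  have hv2 := norm_plane hv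
  set z : ℂ := ⟨v 0, v 1⟩ with hz
  have hn : ‖z‖ = 1 := by
    rw [← sq_eq_sq₀ (norm_nonneg z) zero_le_one, Complex.sq_norm, Complex.normSq_apply]
    simp [hz]
    linarith
  have hz0 : z ≠ 0 := by
    intro h
    simp [h] at hn
  refine ⟨toIcoMod Real.two_pi_pos 0 z.arg,
    by simpa using toIcoMod_mem_Ico Real.two_pi_pos 0 z.arg, ?_⟩
  have h1 : dirOfAngle (toIcoMod Real.two_pi_pos 0 z.arg) = dirOfAngle z.arg := by
    refine dirOfAngle_eq_iff.2 ⟨-toIcoDiv Real.two_pi_pos 0 z.arg, ?_⟩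
    rw [toIcoMod]
    push_cast
    rw [zsmul_eq_mul]
    ring
  rw [h1]
  ext i
  fin_cases i
  · change Real.cos z.arg = v 0
    rw [Complex.cos_arg hz0, hn, div_one]
  · change Real.sin z.arg = v 1
    rw [Complex.sin_arg, hn, div_one]

/-- The directions of a finite set, listed by increasing angle. -/
lemma exists_angle_list (Ω : Finset Plane) (hΩ : ∀ v ∈ Ω, ‖v‖ = 1) :
    ∃ θ : ℕ → ℝ, StrictMonoOn θ (Set.Iio Ω.card) ∧
      (∀ i < Ω.card, θ i ∈ Set.Ico 0 (2 * Real.pi)) ∧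
      (Ω : Set Plane) = (fun i => dirOfAngle (θ i)) '' Set.Iio Ω.card := by
  classical
  choose! ang hang hdir using fun v (hv : v ∈ Ω) => exists_dirOfAngle (hΩ v hv)
  have hinj : Set.InjOn ang Ω := fun v hv w hw h => by rw [← hdir v hv, ← hdir w hw, h]
  set T := Ω.image ang with hT
  have hcard : T.card = Ω.card := Finset.card_image_of_injOn hinj
  have hmem : ∀ i, T.orderEmbOfFin hcard i ∈ T := fun i => T.orderEmbOfFin_mem hcard i
  refine ⟨fun i => if h : i < Ω.card then T.orderEmbOfFin hcard ⟨i, h⟩ else 0, ?_, ?_, ?_⟩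
  · intro i hi j hj hij
    have hi' : i < Ω.card := hi
    have hj' : j < Ω.card := hj
    simp only [hi', hj', dif_pos]
    exact (T.orderEmbOfFin hcard).strictMono hij
  · intro i hi
    simp only [hi, dif_pos]
    obtain ⟨v, hv, h⟩ := Finset.mem_image.1 (hmem ⟨i, hi⟩)
    rw [← h]
    exact hang v hv
  · ext v
    constructor
    · intro hv
      have h1 : ang v ∈ Set.range (T.orderEmbOfFin hcard) := by
        rw [Finset.range_orderEmbOfFin]
        exact Finset.mem_image_of_mem ang hv
      obtain ⟨i, hi⟩ := h1
      refine ⟨i, i.2, ?_⟩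
      simp only [i.2, dif_pos, Fin.eta, hi]
      exact hdir v hv
    · rintro ⟨i, hi, rfl⟩
      have hi' : i < Ω.card := hi
      obtain ⟨v, hv, h⟩ := Finset.mem_image.1 (hmem ⟨i, hi'⟩)
      simp only [hi', dif_pos, ← h, hdir v hv]
      exact hv

end Angles

/-! ### Finite sets of directions are lacunary of logarithmic order -/

section Lacunary

lemma isOneLacunary_of_subsingleton {Ω : Set Plane} (h : Ω.Subsingleton)
    (h1 : ∀ v ∈ Ω, ‖v‖ = 1) : IsOneLacunary Ω := by
  rcases h.eq_empty_or_singleton with rfl | ⟨x, rfl⟩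
  · exact ⟨0, fun _ => 0, dirOfAngle 0, by simp, by simp, by simp, norm_dirOfAngle 0, by simp⟩
  · have e : {k : ℕ | (k : ℕ∞) < 1} = {0} := by
      ext k
      simp
    refine ⟨1, fun _ => x, dirOfAngle 0, ?_, ?_, fun _ _ => h1 x rfl, norm_dirOfAngle 0, ?_⟩
    · rw [e]
      simp
    · rw [e]
      simp
    · intro k hk
      have : k + 1 < 1 := by exact_mod_cast hk
      omega

lemma isGap_pair {α β : ℝ} (hα : α ∈ Set.Ico 0 (2 * Real.pi))
    (hβ : β ∈ Set.Ico 0 (2 * Real.pi)) (h : α < β) :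
    IsGap {dirOfAngle α, dirOfAngle β} α β := by
  refine ⟨h, by linarith [hα.1, hβ.2], by simp, by simp, ?_⟩
  rw [Set.disjoint_left]
  rintro _ ⟨φ, ⟨h1, h2⟩, rfl⟩ hφ
  have hφ2 : φ ∈ Set.Ico 0 (2 * Real.pi) := ⟨hα.1.trans h1.le, h2.trans hβ.2⟩
  rcases hφ with hφ | hφ
  · exact h1.ne' (dirOfAngle_injOn hφ2 hα hφ)
  · exact h2.ne (dirOfAngle_injOn hφ2 hβ hφ)

lemma isOneLacunary_pair {α β : ℝ} (hα : α ∈ Set.Ico 0 (2 * Real.pi))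
    (hβ : β ∈ Set.Ico 0 (2 * Real.pi)) (h : α < β) :
    IsOneLacunary {dirOfAngle α, dirOfAngle β} := by
  have hne : dirOfAngle α ≠ dirOfAngle β := fun hab => h.ne (dirOfAngle_injOn hα hβ hab)
  set d := ‖dirOfAngle α - dirOfAngle β‖ with hd
  have hdpos : 0 < d := norm_pos_iff.2 (sub_ne_zero.2 hne)
  -- the limit direction: at distance `3 d / 4` from the second point
  obtain ⟨φ, -, hφ⟩ : ∃ φ ∈ Set.uIcc β α, ‖dirOfAngle β - dirOfAngle φ‖ = 3 / 4 * d := by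
    have hc : ContinuousOn (fun φ => ‖dirOfAngle β - dirOfAngle φ‖) (Set.uIcc β α) :=
      (continuous_const.sub continuous_dirOfAngle).norm.continuousOn
    refine intermediate_value_uIcc hc ?_
    simp only [sub_self, norm_zero]
    rw [norm_sub_rev, ← hd, Set.uIcc_of_le hdpos.le]
    constructor <;> linarith
  have e : {k : ℕ | (k : ℕ∞) < 2} = {0, 1} := by
    ext k
    have : ((k : ℕ∞) < 2) ↔ k < 2 := by exact_mod_cast Iff.rfl
    simp only [Set.mem_ofPred_eq, this, Set.mem_insert_iff, Set.mem_singleton_iff]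
    omega
  refine ⟨2, fun k => if k = 0 then dirOfAngle α else dirOfAngle β, dirOfAngle φ, ?_, ?_, ?_,
    norm_dirOfAngle φ, ?_⟩
  · rw [e]
    simp [Set.image_pair]
  · rw [e]
    intro i hi j hj hij
    rcases hi with rfl | rfl <;> rcases hj with rfl | rfl <;> simp_all
  · intro k _
    dsimp only
    split_ifs <;> exact norm_dirOfAngle _
  · intro k hk
    have hk2 : k + 1 < 2 := by exact_mod_cast hk
    obtain rfl : k = 0 := by omega
    simp only [if_true, zero_add, one_ne_zero, if_false]
    rw [hφ, ← hd]
    exact ⟨⟨α, β, isGap_pair hα hβ h, .inl ⟨rfl, rfl⟩⟩, by linarith, by linarith⟩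

/-- Every `2 ^ j`-th direction of a list of `n` directions. -/
def dyadicDirs (θ : ℕ → ℝ) (n j : ℕ) : Set Plane :=
  (fun i => dirOfAngle (θ i)) '' {i | i < n ∧ 2 ^ j ∣ i}

variable {θ : ℕ → ℝ} {n : ℕ}

lemma dyadicDirs_anti (j : ℕ) : dyadicDirs θ n (j + 1) ⊆ dyadicDirs θ n j :=
  Set.image_mono fun _ hi => ⟨hi.1, (pow_dvd_pow 2 (Nat.le_succ j)).trans hi.2⟩

lemma odd_of_notMem {j i : ℕ} (hi : i < n) (hd : 2 ^ j ∣ i)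
    (h : dirOfAngle (θ i) ∉ dyadicDirs θ n (j + 1)) : ∃ k, i = 2 ^ (j + 1) * k + 2 ^ j := by
  obtain ⟨r, rfl⟩ := hd
  rcases Nat.even_or_odd' r with ⟨k, rfl | rfl⟩
  · exact absurd ⟨_, ⟨hi, ⟨k, by ring⟩⟩, rfl⟩ h
  · exact ⟨k, by ring⟩

/-- In a gap of the coarser set there is at most one point of the finer one: between two of them
there is a point of the coarser set, namely the next one in the list, or the first one of the list
if the arc between them passes through the angle `0`. -/
lemma subsingleton_dyadicDirs_inter (hmono : StrictMonoOn θ (Set.Iio n))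
    (hθ : ∀ i < n, θ i ∈ Set.Ico 0 (2 * Real.pi)) {j : ℕ} {s t : ℝ}
    (hgap : IsGap (dyadicDirs θ n (j + 1)) s t) :
    (dyadicDirs θ n j ∩ openArc s t).Subsingleton := by
  obtain ⟨-, hlt, -, -, hdisj⟩ := hgap
  have hpi := Real.pi_pos
  -- two finer points at angles `a < b` of the gap lead to a contradiction
  have key : ∀ i i', i < n → i' < n → 2 ^ j ∣ i → 2 ^ j ∣ i' →
      ∀ a b, a ∈ Set.Ioo s t → b ∈ Set.Ioo s t → a < b →
      dirOfAngle (θ i) = dirOfAngle a → dirOfAngle (θ i') = dirOfAngle b →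
      dirOfAngle (θ i) ∉ dyadicDirs θ n (j + 1) → b < a + 2 * Real.pi → False := by
    intro i i' hi hi' hd hd' a b ha hb hab hia hib hnot hba
    obtain ⟨k, hk⟩ := dirOfAngle_eq_iff.1 hia.symm
    obtain ⟨k', hk'⟩ := dirOfAngle_eq_iff.1 hib.symm
    have h1 := hθ i hi
    have h2 := hθ i' hi'
    have h3 : (k : ℝ) - 1 < k' := by nlinarith [h1.1, h2.2]
    have h4 : (k' : ℝ) < k + 2 := by nlinarith [h1.2, h2.1]
    have h5 : k - 1 < k' := by exact_mod_cast h3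
    have h6 : k' < k + 2 := by exact_mod_cast h4
    obtain hkk | hkk : k' = k ∨ k' = k + 1 := by omega
    · have hlt : i < i' := by
        rw [← hmono.lt_iff_lt hi hi']
        rw [hkk] at hk'
        linarith
      obtain ⟨r, hr⟩ := odd_of_notMem hi hd hnot
      have hle : i + 2 ^ j ≤ i' := by
        have := Nat.le_of_dvd (by omega) (Nat.dvd_sub hd' hd)
        omega
      have hen : i + 2 ^ j < n := by omega
      have h7 : θ i < θ (i + 2 ^ j) :=
        hmono hi hen (Nat.lt_add_of_pos_right (Nat.two_pow_pos j))
      have h8 : θ (i + 2 ^ j) ≤ θ i' := hmono.monotoneOn hen hi' hle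
      refine Set.disjoint_left.1 hdisj ⟨θ (i + 2 ^ j) + 2 * Real.pi * k, ⟨?_, ?_⟩, rfl⟩
        ⟨i + 2 ^ j, ⟨hen, ⟨r + 1, by rw [hr]; ring⟩⟩, (dirOfAngle_add_int_mul _ _).symm⟩
      · linarith [ha.1]
      · rw [hkk] at hk'
        linarith [hb.2]
    · have h0 : 0 < n := by omega
      have h7 : θ 0 ≤ θ i' := hmono.monotoneOn h0 hi' (Nat.zero_le _)
      have h8 := (hθ 0 h0).1
      refine Set.disjoint_left.1 hdisj ⟨θ 0 + 2 * Real.pi * k', ⟨?_, ?_⟩, rfl⟩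
        ⟨0, ⟨h0, dvd_zero _⟩, (dirOfAngle_add_int_mul _ _).symm⟩
      · rw [hkk]
        push_cast
        linarith [ha.1, h1.2]
      · linarith [hb.2]
  have hnotMem : ∀ a ∈ Set.Ioo s t, dirOfAngle a ∉ dyadicDirs θ n (j + 1) := fun a ha =>
    Set.disjoint_left.1 hdisj ⟨a, ha, rfl⟩
  rintro x ⟨⟨i, ⟨hi, hd⟩, hix⟩, a, ha, hax⟩ y ⟨⟨i', ⟨hi', hd'⟩, hiy⟩, b, hb, hby⟩
  have hia : dirOfAngle (θ i) = dirOfAngle a := hix.trans hax.symm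
  have hib : dirOfAngle (θ i') = dirOfAngle b := hiy.trans hby.symm
  rcases lt_trichotomy a b with hab | hab | hab
  · exact (key i i' hi hi' hd hd' a b ha hb hab hia hib (hia ▸ hnotMem a ha)
      (by linarith [ha.1, hb.2])).elim
  · rw [← hax, ← hby, hab]
  · exact (key i' i hi' hi hd' hd b a hb ha hab hib hia (hib ▸ hnotMem b hb)
      (by linarith [hb.1, ha.2])).elim

/-- Each new direction lies in the gap between the preceding and the following coarser ones; the
latter is the first direction of the list if the list ends before. -/
lemma exists_gap_of_mem_dyadicDirs (hmono : StrictMonoOn θ (Set.Iio n))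
    (hθ : ∀ i < n, θ i ∈ Set.Ico 0 (2 * Real.pi)) {j : ℕ} (hj : 2 ^ (j + 1) < n) {x : Plane}
    (hx : x ∈ dyadicDirs θ n j) (hx' : x ∉ dyadicDirs θ n (j + 1)) :
    ∃ s t : ℝ, IsGap (dyadicDirs θ n (j + 1)) s t ∧ x ∈ openArc s t := by
  have hpi := Real.pi_pos
  obtain ⟨i, ⟨hi, hd⟩, rfl⟩ := hx
  obtain ⟨r, hr⟩ := odd_of_notMem hi hd hx'
  have h2j : 2 ^ (j + 1) = 2 * 2 ^ j := pow_succ' 2 j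
  have h2pos := Nat.two_pow_pos j
  set p := 2 ^ (j + 1) * r with hp
  have hpn : p < n := by omega
  have hpi' : θ p < θ i := hmono hpn hi (by omega)
  have hmem : ∀ e < n, 2 ^ (j + 1) ∣ e → dirOfAngle (θ e) ∈ dyadicDirs θ n (j + 1) :=
    fun e he hde => ⟨e, ⟨he, hde⟩, rfl⟩
  -- no coarser index lies strictly between `p` and `p + 2 ^ (j + 1)`
  have hnone : ∀ e, 2 ^ (j + 1) ∣ e → p < e → p + 2 ^ (j + 1) ≤ e := by
    intro e he hpe
    have := Nat.le_of_dvd (by omega) (Nat.dvd_sub he (Dvd.intro r rfl : 2 ^ (j + 1) ∣ p))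
    omega
  rcases Nat.lt_or_ge (p + 2 ^ (j + 1)) n with hq | hq
  · have hiq : θ i < θ (p + 2 ^ (j + 1)) := hmono hi hq (by omega)
    refine ⟨θ p, θ (p + 2 ^ (j + 1)), ⟨hpi'.trans hiq, ?_, hmem _ hpn (Dvd.intro r rfl),
      hmem _ hq ⟨r + 1, by rw [hp]; ring⟩, ?_⟩, θ i, ⟨hpi', hiq⟩, rfl⟩
    · linarith [(hθ p hpn).1, (hθ _ hq).2]
    · rw [Set.disjoint_left]
      rintro _ ⟨φ, ⟨h1, h2⟩, rfl⟩ ⟨e, ⟨he, hde⟩, heφ⟩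
      have hφ : φ ∈ Set.Ico 0 (2 * Real.pi) := ⟨(hθ p hpn).1.trans h1.le, h2.trans (hθ _ hq).2⟩
      obtain rfl : θ e = φ := dirOfAngle_injOn (hθ e he) hφ heφ
      have h3 := (hmono.lt_iff_lt hpn he).1 h1
      have h4 := (hmono.lt_iff_lt he hq).1 h2
      have h5 := hnone e hde h3
      omega
  · have h0 : 0 < n := by omega
    -- the list has at least two coarser directions, so the gap is not the full circle
    have hppos : 0 < p := by omega
    have h0p : θ 0 < θ p := hmono h0 hpn hppos
    have hi2 : θ i < θ 0 + 2 * Real.pi := by linarith [(hθ i hi).2, (hθ 0 h0).1]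
    refine ⟨θ p, θ 0 + 2 * Real.pi, ⟨hpi'.trans hi2, by linarith, hmem _ hpn (Dvd.intro r rfl), ?_,
      ?_⟩, θ i, ⟨hpi', hi2⟩, rfl⟩
    · rw [dirOfAngle_add_two_pi]
      exact hmem 0 h0 (dvd_zero _)
    · rw [Set.disjoint_left]
      rintro _ ⟨φ, ⟨h1, h2⟩, rfl⟩ ⟨e, ⟨he, hde⟩, heφ⟩
      have h3 : φ < 2 * Real.pi := by
        by_contra h3
        rw [not_lt] at h3
        have hφ : φ - 2 * Real.pi ∈ Set.Ico 0 (2 * Real.pi) :=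
          ⟨by linarith, by linarith [(hθ 0 h0).2]⟩
        have h4 : dirOfAngle (θ e) = dirOfAngle (φ - 2 * Real.pi) := by
          rw [← dirOfAngle_add_two_pi (φ - 2 * Real.pi), sub_add_cancel]
          exact heφ
        have h5 := dirOfAngle_injOn (hθ e he) hφ h4
        have h6 := hmono.monotoneOn h0 he (Nat.zero_le e)
        linarith
      obtain rfl : θ e = φ :=
        dirOfAngle_injOn (hθ e he) ⟨(hθ p hpn).1.trans h1.le, h3⟩ heφ
      have h4 := hnone e hde ((hmono.lt_iff_lt hpn he).1 h1)
      have : e < n := he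
      omega

lemma isLacunary_dyadicDirs (hmono : StrictMonoOn θ (Set.Iio n))
    (hθ : ∀ i < n, θ i ∈ Set.Ico 0 (2 * Real.pi)) (k : ℕ) :
    ∀ j, 2 ^ (j + k) < n → n ≤ 2 ^ (j + k + 1) → IsLacunary (k + 1) (dyadicDirs θ n j) := by
  induction k with
  | zero =>
    intro j h1 h2
    simp only [add_zero] at h1 h2
    have h0 : 0 < n := by omega
    have h2j : 2 ^ (j + 1) = 2 * 2 ^ j := pow_succ' 2 j
    have e : {i | i < n ∧ 2 ^ j ∣ i} = {0, 2 ^ j} := by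
      ext i
      simp only [Set.mem_ofPred_eq, Set.mem_insert_iff, Set.mem_singleton_iff]
      constructor
      · rintro ⟨hi, r, rfl⟩
        have hr : r < 2 := by
          by_contra hr
          have := Nat.mul_le_mul_left (2 ^ j) (not_lt.1 hr)
          omega
        interval_cases r <;> simp
      · rintro (rfl | rfl)
        · exact ⟨h0, dvd_zero _⟩
        · exact ⟨h1, dvd_rfl⟩
    refine IsLacunary.one _ ?_
    rw [dyadicDirs, e, Set.image_pair]
    exact isOneLacunary_pair (hθ 0 h0) (hθ _ h1) (hmono h0 h1 (Nat.two_pow_pos j))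
  | succ k ih =>
    intro j h1 h2
    rw [show j + (k + 1) = j + 1 + k by ring] at h1 h2
    refine IsLacunary.succ (k + 1) (dyadicDirs θ n (j + 1)) _ (ih (j + 1) h1 h2)
      (dyadicDirs_anti j) (fun x hx hx' => ?_) (fun s t hst => ?_)
    · exact exists_gap_of_mem_dyadicDirs hmono hθ
        ((Nat.pow_le_pow_right (by norm_num) (Nat.le_add_right _ _)).trans_lt h1) hx hx'
    · refine isOneLacunary_of_subsingleton (subsingleton_dyadicDirs_inter hmono hθ hst) ?_
      rintro v ⟨⟨i, -, rfl⟩, -⟩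
      exact norm_dirOfAngle _

theorem exists_isLacunary_le_log : ∃ C : ℝ, 0 < C ∧
    ∀ Ω : Finset Plane, (∀ v ∈ Ω, ‖v‖ = 1) → 2 ≤ Ω.card →
      ∃ N : ℕ, (N : ℝ) ≤ C * Real.log (Ω.card : ℝ) ∧ IsLacunary N (Ω : Set Plane) := by
  have hlog2 : 0 < Real.log 2 := Real.log_pos (by norm_num)
  refine ⟨2 / Real.log 2, by positivity, fun Ω hΩ hn => ?_⟩
  obtain ⟨θ, hmono, hθ, hΩθ⟩ := exists_angle_list Ω hΩ
  set n := Ω.card with hnn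
  set k := Nat.log 2 (n - 1) with hk
  have h1 : 2 ^ k < n := by
    have := Nat.pow_log_le_self 2 (show n - 1 ≠ 0 by omega)
    rw [← hk] at this
    omega
  have h2 : n ≤ 2 ^ (k + 1) := by
    have := Nat.lt_pow_succ_log_self (b := 2) (by norm_num) (n - 1)
    rw [Nat.succ_eq_add_one, ← hk] at this
    omega
  refine ⟨k + 1, ?_, ?_⟩
  · have h3 : k * Real.log 2 ≤ Real.log n := by
      rw [← Real.log_pow]
      exact Real.log_le_log (by positivity) (by exact_mod_cast h1.le)
    have h4 : Real.log 2 ≤ Real.log n := Real.log_le_log (by norm_num) (by exact_mod_cast hn)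
    rw [div_mul_eq_mul_div, le_div_iff₀ hlog2]
    push_cast
    linarith
  · have e : (Ω : Set Plane) = dyadicDirs θ n 0 := by
      rw [hΩθ, dyadicDirs]
      congr 1
      ext i
      simp
    rw [e]
    exact isLacunary_dyadicDirs hmono hθ k 0 (by simpa using h1) (by simpa using h2)

end Lacunary

theorem mainTheorem2 :
    (∃ C : ℝ, 0 < C ∧ ∀ Ω : Finset Plane, (∀ v ∈ Ω, ‖v‖ = 1) → 2 ≤ Ω.card →
      ∃ N : ℕ, (N : ℝ) ≤ C * Real.log (Ω.card : ℝ) ∧ IsLacunary N (Ω : Set Plane)) ∧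
    (∃ K : ℝ, 0 < K ∧ ∀ Ω : Finset Plane, (∀ v ∈ Ω, ‖v‖ = 1) → 2 ≤ Ω.card →
      ∀ f : Plane → ℂ, MemLp f 2 volume →
        Measurable (dirMaximal (Ω : Set Plane) f) ∧
        eLpNorm (dirMaximal (Ω : Set Plane) f) 2 volume ≤
          ENNReal.ofReal (K * Real.log (Ω.card : ℝ)) * eLpNorm f 2 volume) := by
  exact ⟨exists_isLacunary_le_log, eLpNorm_dirMaximal_le⟩
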